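/- **Conventions.** Manifolds are topological and may have boundary; $\partial M$ is the manifold boundary of $M$. A *metric $n$-manifold* is an $n$-manifold with a fixed compatible metric; $\mathrm{Int}_X$, $\mathrm{Fr}_X$ are topological interior and frontier in $X$, and subsets carry the restricted metric. For a metric $n$-manifold $(M,d)$ and $F,C\subset M$, let $i_F:F\subset M$ be the inclusion and let $\mathcal E^u_\ast(F,M;C)$ be the space of uniform embeddings $f:F\to M$ (uniformly continuous injections whose inverse $f(F)\to F$ is uniformly continuous) that are proper ($f^{-1}(\partial M)=F\cap\partial M$) and satisfy $f=\mathrm{id}$ on $F\cap C$, with the (possibly infinite) sup-metric $d(f,g)=\sup_{x\in F}d(f(x),g(x))$ and its topology. Put $$\mathcal E^u_\ast(F,M;C)_b=\{f\in\mathcal E^u_\ast(F,M;C): d(f,i_F)<\infty\},\qquad \mathcal E^u_\ast(i_F,\alpha;F,M)=\{f\in\mathcal E^u_\ast(F,M;\emptyset): d(f,i_F)<\alpha\},$$ and omit $C$ when $C=\emptyset$. **Ends.** An ($n$-dimensional) *proper product end* is a metric $n$-manifold $(L,d)$ such that $d$ is proper (bounded closed sets are compact) and there is a homeomorphism $\theta:S\times[1,\infty)\approx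 L$ for some compact $(n-1)$-manifold $S$; fix such a $\theta$ and put $L_r=\theta(S\times[r,\infty))$ for $r\ge 1$. Let $\mathcal{CF}(L)$ be the collection of closed subsets $F$ of $L$ such that $L-F$ is relatively compact in $L$. The end $(L,d)$ has *property (ED)* if for every $F\in\mathcal{CF}(L)$ and $\alpha>0$ there are $\beta>0$, $H\in\mathcal{CF}(L)$ with $H\subset F$, and a continuous map $$\phi:\mathcal E^u_\ast(i_F,\alpha;F,L)\times[0,1]\to\mathcal E^u_\ast(i_F,\beta;F,L)$$ such that for all $f$ and $t$: $\phi_0(f)=f$; $\phi_1(f)=\mathrm{id}$ on $H$; if $f=\mathrm{id}$ on $F\cap\partial L$ then $\phi_t(f)=\mathrm{id}$ on $F\cap\partial L$; $\phi_t(i_F)=i_F$; and $\phi_t(f)=f$ on $\mathrm{Fr}_LF$. An *isolated proper product end* of a metric $n$-manifold $(M,d)$ is a closed subset $L\subset M$ such that $\mathrm{Fr}_ML$ is compact, $(L,d|_L)$ is an $n$-dimensional proper product end, and for every $c>0$ there is $G\in\mathcal{CF}(L)$ with $d(M-L,G)>c$ (the distance between two sets is the infimum of the distances of their points, $\infty$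 if one of them is empty). Let $\mathcal{CF}(M,L)$ be the collection of closed subsets $F$ of $M$ with $F\cap L\in\mathcal{CF}(L)$. **Theorem.** Let $(M,d)$ be a metric $n$-manifold and let $L(1),\dots,L(m)\subset M$ be pairwise disjoint isolated proper product ends of $M$ such that each $(L(i),d|_{L(i)})$ has property (ED). Let $F\subset M$ with $F\in\mathcal{CF}(M,L(i))$ for $i=1,\dots,m$, and let $s_i>r_i>1$ with $L(i)_{r_i}\subset\mathrm{Int}_M(F\cap L(i))$ for $i=1,\dots,m$. Put $A=\bigcup_{i=1}^mL(i)_{r_i}$. Then there is a strong deformation retraction $$\phi\ \text{ of }\ \mathcal E^u_\ast(F,M)_b\ \text{ onto }\ \mathcal E^u_\ast\Big(F,M;\bigcup_{i=1}^mL(i)_{s_i}\Big)_b,$$ that is, a continuous map $\phi:\mathcal E^u_\ast(F,M)_b\times[0,1]\to\mathcal E^u_\ast(F,M)_b$ with $\phi_0=\mathrm{id}$, with $\phi_1$ taking values in the subspace, and with every $\phi_t$ fixing each point of the subspace, such that: 1. for each $(f,t)\in\mathcal E^u_\ast(F,M)_b\times[0,1]$: - (i) $\phi_t(f)=f$ on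 $f^{-1}(M-\mathrm{Int}_MA)-\mathrm{Int}_MA$; - (ii) if $A\subset f(F)$, then $\phi_t(f)(F)=f(F)$; - (iii) if $f=\mathrm{id}$ on $F\cap\partial M$, then $\phi_t(f)=\mathrm{id}$ on $F\cap\partial M$; 2. for each $\alpha>0$ there exists $\beta>0$ such that $\phi\big(\mathcal E^u_\ast(i_F,\alpha;F,M)\times[0,1]\big)\subset\mathcal E^u_\ast(i_F,\beta;F,M)$. -/

import Mathlib

open Set Topology UniformConvergence

namespace MetricEnd

noncomputable section

/-! ### Topological manifolds with boundary -/

/-- The closed half space `{x ∈ ℝⁿ | xₙ ≥ 0}` (a single point for `n = 0`). -/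
def halfSpace (n : ℕ) : Set (EuclideanSpace ℝ (Fin n)) :=
  {x | ∀ i : Fin n, i.val + 1 = n → 0 ≤ x i}

/-- Topological `n`-manifolds, possibly with boundary: Hausdorff spaces in which every point has an
open neighbourhood homeomorphic to an open subset of the half space. Second countability is not
demanded. -/
structure IsManifoldWithBoundary (n : ℕ) (X : Type*) [TopologicalSpace X] : Prop where
  t2 : T2Space X
  chart : ∀ x : X, ∃ e : OpenPartialHomeomorph X (halfSpace n), x ∈ e.source

/-- The interior of an `n`-manifold as a manifold: the points that have an open neighbourhood
homeomorphic to an open subset of `ℝⁿ`. -/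
def manifoldInterior (n : ℕ) (X : Type*) [TopologicalSpace X] : Set X :=
  {x | ∃ e : OpenPartialHomeomorph X (EuclideanSpace ℝ (Fin n)), x ∈ e.source}

/-- The boundary of an `n`-manifold as a manifold. -/
def manifoldBoundary (n : ℕ) (X : Type*) [TopologicalSpace X] : Set X :=
  (manifoldInterior n X)ᶜ

/-! ### Spaces of proper uniform embeddings

`F →ᵤ X` is the type of functions `F → X` with the extended sup-metric and the topology of uniform
convergence. -/

/-- The inclusion map `i_F : F → X`. -/
def incl {X : Type*} (F : Set X) : F →ᵤ X := UniformFun.ofFun (fun x : F => (x : X))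

/-- `ℰᵘ_*(F, X; C)`: the uniform embeddings `f : F → X` into the metric `n`-manifold `X` that are
proper, i.e. `f⁻¹(∂X) = F ∩ ∂X`, and are the identity on `F ∩ C`. -/
def properEmb {X : Type*} [MetricSpace X] (n : ℕ) (F C : Set X) : Set (F →ᵤ X) :=
  {f | IsUniformEmbedding (UniformFun.toFun f) ∧
    (∀ x : F, UniformFun.toFun f x ∈ manifoldBoundary n X ↔ (x : X) ∈ manifoldBoundary n X) ∧
    ∀ x : F, (x : X) ∈ C → UniformFun.toFun f x = x}

/-- `ℰᵘ_*(F, X; C)_b`: the members of `ℰᵘ_*(F, X; C)` at finite sup-distance from `i_F`. -/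
def boundedEmb {X : Type*} [MetricSpace X] (n : ℕ) (F C : Set X) : Set (F →ᵤ X) :=
  {f | f ∈ properEmb n F C ∧ edist f (incl F) < ⊤}

/-- `ℰᵘ_*(i_F, α; F, X; C)`: the open `α`-neighbourhood of `i_F` in `ℰᵘ_*(F, X; C)`. -/
def ballEmb {X : Type*} [MetricSpace X] (n : ℕ) (F C : Set X) (α : ℝ) : Set (F →ᵤ X) :=
  {f | f ∈ properEmb n F C ∧ edist f (incl F) < ENNReal.ofReal α}

/-! ### Deformations -/

/-- `φ : W × [0,1] → V`, where `W` and `V` are subspaces of `ℰᵘ_*(F, X)`, is an admissible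
deformation over `H`. -/
structure IsAdmissibleDeformation {X : Type*} [MetricSpace X] (n : ℕ) (F H : Set X)
    (W V : Set (F →ᵤ X)) (φ : W × unitInterval → V) : Prop where
  continuous : Continuous φ
  zero : ∀ f : W, (φ (f, 0) : F →ᵤ X) = f
  one : ∀ (f : W) (x : F), (x : X) ∈ H → UniformFun.toFun (φ (f, 1) : F →ᵤ X) x = x
  boundary : ∀ f : W,
    (∀ x : F, (x : X) ∈ manifoldBoundary n X → UniformFun.toFun (f : F →ᵤ X) x = x) →
    ∀ (t : unitInterval) (x : F), (x : X) ∈ manifoldBoundary n X →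
      UniformFun.toFun (φ (f, t) : F →ᵤ X) x = x
  incl : ∀ f : W, (f : F →ᵤ X) = incl F →
    ∀ t : unitInterval, (φ (f, t) : F →ᵤ X) = MetricEnd.incl F

/-- `φ` is a strong deformation retraction of the space `Y` onto its subspace `A`. -/
structure IsStrongDeformationRetraction {Y : Type*} [TopologicalSpace Y] (A : Set Y)
    (φ : Y × unitInterval → Y) : Prop where
  continuous : Continuous φ
  zero : ∀ y, φ (y, 0) = y
  one : ∀ y, φ (y, 1) ∈ A
  fixed : ∀ y ∈ A, ∀ t, φ (y, t) = y

/-! ### Proper product ends -/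

/-- `CF(L)`: the closed subsets of `L` whose complement is relatively compact in `L`. -/
def IsCofinal {L : Type*} [TopologicalSpace L] (F : Set L) : Prop :=
  IsClosed F ∧ IsCompact (closure Fᶜ)

/-- The metric space `L`, with the homeomorphism `θ : S × [1, ∞) ≈ L`, is an `n`-dimensional proper
product end: `L` is a metric `n`-manifold with a proper metric and `S` is a compact
`(n-1)`-manifold. -/
structure IsProperProductEnd (n : ℕ) {L S : Type*} [MetricSpace L] [TopologicalSpace S]
    (θ : S × Ici (1 : ℝ) ≃ₜ L) : Prop where
  manifold : IsManifoldWithBoundary n L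
  proper : ProperSpace L
  compact : CompactSpace S
  base : ∃ k : ℕ, n = k + 1 ∧ IsManifoldWithBoundary k S

/-- The property (ED) of an `n`-dimensional proper product end `L`. -/
def HasED (n : ℕ) (L : Type*) [MetricSpace L] : Prop :=
  ∀ F : Set L, IsCofinal F → ∀ α : ℝ, 0 < α →
    ∃ β : ℝ, 0 < β ∧ ∃ H : Set L, IsCofinal H ∧ H ⊆ F ∧
      ∃ φ : ballEmb n F ∅ α × unitInterval → ballEmb n F ∅ β,
        IsAdmissibleDeformation n F H (ballEmb n F ∅ α) (ballEmb n F ∅ β) φ ∧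
        ∀ (f : ballEmb n F ∅ α) (t : unitInterval) (x : F), (x : L) ∈ frontier F →
          UniformFun.toFun (φ (f, t) : F →ᵤ L) x = UniformFun.toFun (f : F →ᵤ L) x

/-- The distance `d(A, B) = inf {d(a, b) | a ∈ A, b ∈ B}`, with value `∞` if `A` or `B` is empty. -/
def setDist {M : Type*} [MetricSpace M] (A B : Set M) : ENNReal :=
  ⨅ a ∈ A, ⨅ b ∈ B, edist a b

/-- The subset `L` of the metric `n`-manifold `M`, with the homeomorphism `θ : S × [1, ∞) ≈ L`, is
an isolated proper product end of `M`. -/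
structure IsIsolatedProperProductEnd (n : ℕ) {M S : Type*} [MetricSpace M] [TopologicalSpace S]
    (L : Set M) (θ : S × Ici (1 : ℝ) ≃ₜ L) : Prop where
  closed : IsClosed L
  frontier : IsCompact (frontier L)
  productEnd : IsProperProductEnd n θ
  isolated : ∀ c : ℝ, 0 < c → ∃ G : Set L, IsCofinal G ∧
    ENNReal.ofReal c < setDist Lᶜ (Subtype.val '' G)

/-- `L_r = θ(S × [r, ∞))`, as a subset of `M`. -/
def tail {M S : Type*} [MetricSpace M] [TopologicalSpace S] {L : Set M}
    (θ : S × Ici (1 : ℝ) ≃ₜ L) (r : ℝ) : Set M :=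
  {x | ∃ p : S × Ici (1 : ℝ), r ≤ (p.2 : ℝ) ∧ (θ p : M) = x}

/-- `CF(M, L)`: the closed subsets `F` of `M` such that `F ∩ L` belongs to `CF(L)`. -/
def IsCofinalIn {M : Type*} [MetricSpace M] (F L : Set M) : Prop :=
  IsClosed F ∧ IsCofinal (Subtype.val ⁻¹' F : Set L)

end

end MetricEnd

/-!
The retraction is built for one end `L` at a time, as the retraction for one end does not affect the
embeddings over the others (`exists_retraction_of_ends`).

For a single end and a bound `R`, the embeddings `f` at distance less than `R` from the inclusion
are deformed by the composite of two deformations.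

* `exists_deformation_of_hasED`. Far out in `L` such an `f` restricts to an embedding of a tail
  `L_a` into `L`, which property (ED) deforms, relative to the frontier, to an embedding that is the
  identity on a smaller tail `L_b`; it is extended by `f`. The result is again an embedding because
  the image of `L_a` does not change: by invariance of domain the image of the interior of `L_a` is
  open at each time, so a point leaving it would have to cross the fixed image of the frontier
  (`range_subset_of_isotopy`). So the deformed embedding is the composite of `f` with a
  self-homeomorphism of `F` supported in `L_a`, and this is uniform because `L_a` and its complement
  come close to each other only near a compact set (`isUniformEmbedding_glue`).
* `exists_conjugation_deformation`. An embedding that is the identity on `L_b` is conjugated by a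
  homeomorphism of compact support that slides `L_b` to `L_s` along the product structure. In order
  that embeddings which are the identity on `L_s` stay fixed, the slide only fixes `L` up to height
  `s - ε`, where `ε` tends to `0` with the distance of `f` to the identity over `L_s`. The limit of
  the slides collapses the slab between `L_b` and `L_s`, so it cannot be conjugated with, but it
  commutes with the embeddings that are the identity on `L_s`. Since the conjugate `g` of `f` by a
  slide `ρ` is characterised by `g ∘ ρ = ρ ∘ f`, continuity in the limit follows.

The deformations for an increasing sequence of bounds `R` are glued to one on the space of all
bounded embeddings by running each only where the distance to the inclusion lies in a bounded range
and the previous ones are not finished (`exists_strongDeformationRetraction_of_sublevel`). The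
conditions on the supports and the images are transitive relations between an embedding and its
deformed version (`IsModification`), and so are inherited by composites.

Invariance of domain is derived, as in an argument of Tao, from Brouwer's theorem in the form that
there is no `C¹` retraction of the ball to the sphere, for which the proof by volumes of Milnor and
Rogers is used; for manifolds with boundary it follows by reflection.
-/

/-! ### Invariance of domain in Euclidean space -/

namespace InvarianceOfDomain

open MeasureTheory Metric

/-- The determinant of `1 + t A` is a polynomial in `t` of degree at most `dim E`, so that its value
at `t = 1` is a fixed affine combination of its values at `dim E + 1` nodes. -/
lemma exists_det_one_add_eq_sum {E : Type*} [NormedAddCommGroup E] [NormedSpace ℝ E]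
    [FiniteDimensional ℝ E] (v : ℕ → ℝ) (hv : Function.Injective v) :
    ∃ c : ℕ → ℝ, ∑ i ∈ Finset.range (Module.finrank ℝ E + 1), c i = 1 ∧
      ∀ A : E →L[ℝ] E, (1 + A).det =
        ∑ i ∈ Finset.range (Module.finrank ℝ E + 1), c i * (1 + v i • A).det := by
  classical
  set s := Finset.range (Module.finrank ℝ E + 1) with hs
  have key : ∀ p : Polynomial ℝ, p.natDegree ≤ Module.finrank ℝ E →
      p.eval 1 = ∑ i ∈ s, (Lagrange.basis s v i).eval 1 * p.eval (v i) := by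
    intro p hp
    have h1 : p = Lagrange.interpolate s v fun i => p.eval (v i) := by
      refine Lagrange.eq_interpolate (hv.injOn) ?_
      rw [hs, Finset.card_range]
      exact lt_of_le_of_lt (Polynomial.degree_le_of_natDegree_le hp)
        (by exact_mod_cast Nat.lt_succ_self _)
    conv_lhs => rw [h1]
    rw [Lagrange.interpolate_apply, Polynomial.eval_finsetSum]
    refine Finset.sum_congr rfl fun i _ => ?_
    rw [Polynomial.eval_mul, Polynomial.eval_C, mul_comm]
  refine ⟨fun i => (Lagrange.basis s v i).eval 1, ?_, fun A => ?_⟩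
  · have := key 1 (by simp)
    simpa using this.symm
  · let b := Module.finBasis ℝ E
    let Am := LinearMap.toMatrix b b (A : E →ₗ[ℝ] E)
    let p : Polynomial ℝ :=
      ((Polynomial.X : Polynomial ℝ) • Am.map Polynomial.C +
        (1 : Matrix _ _ ℝ).map Polynomial.C).det
    have hp : ∀ t : ℝ, p.eval t = (1 + t • A).det := by
      intro t
      have h1 : p.eval t = (t • Am + 1).det := by
        have h := RingHom.map_det (Polynomial.evalRingHom t)
          ((Polynomial.X : Polynomial ℝ) • Am.map Polynomial.C +
            (1 : Matrix _ _ ℝ).map Polynomial.C)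
        rw [Polynomial.coe_evalRingHom] at h
        refine h.trans (congrArg Matrix.det ?_)
        ext i j
        by_cases hij : i = j <;> simp [hij, mul_comm t]
      have h2 : (1 + t • A).det = LinearMap.det ((1 + t • A : E →L[ℝ] E) : E →ₗ[ℝ] E) := rfl
      rw [h1, h2, ← LinearMap.det_toMatrix b]
      congr 1
      simp [Am, add_comm]
    have hdeg : p.natDegree ≤ Module.finrank ℝ E := by
      simpa only [Fintype.card_fin] using Polynomial.natDegree_det_X_add_C_le Am 1
    have := key p hdeg
    simp only [hp] at this
    simpa using this

/-- A map that is Lipschitz on the closed unit ball and vanishes on the unit sphere stays Lipschitz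
when it is extended by zero. -/
lemma lipschitzWith_indicator {E : Type*} [NormedAddCommGroup E] [NormedSpace ℝ E] {q : E → E}
    {K : NNReal} (hq : LipschitzOnWith K q (closedBall 0 1)) (h0 : ∀ x, ‖x‖ = 1 → q x = 0) :
    LipschitzWith K ((closedBall (0 : E) 1).indicator q) := by
  have aux : ∀ x y : E, x ∈ closedBall (0 : E) 1 → y ∉ closedBall (0 : E) 1 →
      dist (q x) 0 ≤ K * dist x y := by
    intro x y hx hy
    have hx' : ‖x‖ ≤ 1 := by simpa using hx
    have hy' : 1 < ‖y‖ := by simpa using hy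
    -- a point of the unit sphere on the segment from `x` to `y`
    obtain ⟨t, ht, htz⟩ : ∃ t ∈ Icc (0 : ℝ) 1, ‖x + t • (y - x)‖ = 1 := by
      have hc : ContinuousOn (fun t : ℝ => ‖x + t • (y - x)‖) (Icc 0 1) := by fun_prop
      have := intermediate_value_Icc zero_le_one hc
      refine this ⟨by simpa using hx', by simpa using hy'.le⟩
    set z := x + t • (y - x)
    have hz : z ∈ closedBall (0 : E) 1 := by simp [htz]
    calc dist (q x) 0 = dist (q x) (q z) := by rw [h0 z htz]
      _ ≤ K * dist x z := hq.dist_le_mul x hx z hz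
      _ ≤ K * dist x y := by
        gcongr
        rw [dist_eq_norm, dist_eq_norm, ← norm_neg (x - y)]
        have : x - z = -(t • (y - x)) := by simp [z]
        rw [this, norm_neg, norm_smul, Real.norm_of_nonneg ht.1, neg_sub]
        exact mul_le_of_le_one_left (norm_nonneg _) ht.2
  refine LipschitzWith.of_dist_le_mul fun x y => ?_
  by_cases hx : x ∈ closedBall (0 : E) 1 <;> by_cases hy : y ∈ closedBall (0 : E) 1
  · rw [indicator_of_mem hx, indicator_of_mem hy]; exact hq.dist_le_mul x hx y hy
  · rw [indicator_of_mem hx, indicator_of_notMem hy]; exact aux x y hx hy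
  · rw [indicator_of_notMem hx, indicator_of_mem hy, dist_comm, dist_comm x y]; exact aux y x hy hx
  · rw [indicator_of_notMem hx, indicator_of_notMem hy]; simp; positivity

/-- A small Lipschitz perturbation of the identity that is the identity on the unit sphere permutes
the closed unit ball. -/
lemma injOn_image_closedBall {E : Type*} [NormedAddCommGroup E] [NormedSpace ℝ E] [CompleteSpace E]
    {q : E → E} {K : NNReal} (hq : LipschitzOnWith K q (closedBall 0 1))
    (h0 : ∀ x, ‖x‖ = 1 → q x = 0) {t : ℝ} (ht0 : 0 ≤ t) (ht : t * K < 1)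
    (hmaps : ∀ x ∈ closedBall (0 : E) 1, x + t • q x ∈ closedBall (0 : E) 1) :
    InjOn (fun x => x + t • q x) (closedBall 0 1) ∧
      (fun x => x + t • q x) '' closedBall 0 1 = closedBall 0 1 := by
  set Q := (closedBall (0 : E) 1).indicator q
  have hQ : LipschitzWith K Q := lipschitzWith_indicator hq h0
  have hin : ∀ x ∈ closedBall (0 : E) 1, x + t • Q x = x + t • q x := fun x hx => by
    simp only [Q, indicator_of_mem hx]
  have happ : ApproximatesLinearOn (fun x => x + t • Q x)
      ((ContinuousLinearEquiv.refl ℝ E : E ≃L[ℝ] E) : E →L[ℝ] E) univ (t.toNNReal * K) := by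
    intro x _ y _
    have h1 : x + t • Q x - (y + t • Q y) - (x - y) = t • (Q x - Q y) := by
      rw [smul_sub]; abel
    have h2 := hQ.dist_le_mul x y
    rw [dist_eq_norm, dist_eq_norm] at h2
    simp only [ContinuousLinearEquiv.coe_refl, ContinuousLinearMap.coe_id', id, h1]
    rw [norm_smul, Real.norm_of_nonneg ht0, NNReal.coe_mul, Real.coe_toNNReal t ht0, mul_assoc]
    gcongr
  have hc : Subsingleton E ∨
      t.toNNReal * K < ‖((ContinuousLinearEquiv.refl ℝ E).symm : E →L[ℝ] E)‖₊⁻¹ := by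
    rcases subsingleton_or_nontrivial E with h | h
    · exact Or.inl h
    · right
      have : ‖((ContinuousLinearEquiv.refl ℝ E).symm : E →L[ℝ] E)‖₊ = 1 := by
        ext; simp
      rw [this, inv_one, ← NNReal.coe_lt_coe]
      simpa [Real.coe_toNNReal t ht0] using ht
  have hinj := happ.injOn hc
  have hsurj := happ.surjective hc
  refine ⟨fun x hx y hy hxy => ?_, Subset.antisymm ?_ ?_⟩
  · exact hinj trivial trivial (by simpa only [hin x hx, hin y hy] using hxy)
  · rintro _ ⟨x, hx, rfl⟩; exact hmaps x hx
  · intro y hy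
    obtain ⟨x, hx⟩ := hsurj y
    by_cases hxb : x ∈ closedBall (0 : E) 1
    · exact ⟨x, hxb, by simpa only [hin x hxb] using hx⟩
    · simp only [Q, indicator_of_notMem hxb, smul_zero, add_zero] at hx
      exact absurd (hx ▸ hy) hxb

/-- There is no `C¹` retraction of the unit ball onto the unit sphere. The volume
`∫ det (1 + t (Dr - 1))` of the image of the ball under `id + t (r - id)` is a polynomial in `t`
which is constant for small `t`, but vanishes at `t = 1`. -/
theorem not_exists_contDiff_retraction {E : Type*} [NormedAddCommGroup E] [InnerProductSpace ℝ E]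
    [FiniteDimensional ℝ E] (r : E → E) (hr : ContDiff ℝ 1 r) (h1 : ∀ x, ‖r x‖ = 1)
    (hs : ∀ x, ‖x‖ = 1 → r x = x) : False := by
  borelize E
  let μ : Measure E := volume
  set B := closedBall (0 : E) 1 with hB
  have hBc : IsCompact B := isCompact_closedBall 0 1
  set q : E → E := fun x => r x - x with hqdef
  have hqC : ContDiff ℝ 1 q := hr.sub contDiff_id
  have hq0 : ∀ x, ‖x‖ = 1 → q x = 0 := fun x hx => by simp [q, hs x hx]
  set A : E → E →L[ℝ] E := fderiv ℝ q with hA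
  have hAc : Continuous A := hqC.continuous_fderiv one_ne_zero
  have hqA : ∀ x, HasFDerivAt q (A x) x := fun x =>
    (hqC.differentiable one_ne_zero x).hasFDerivAt
  obtain ⟨C, hC⟩ := hBc.exists_bound_of_continuousOn hAc.continuousOn
  set K : NNReal := C.toNNReal with hK
  have hAK : ∀ x ∈ B, ‖A x‖₊ ≤ K := fun x hx => by
    rw [← NNReal.coe_le_coe, coe_nnnorm]
    exact (hC x hx).trans (Real.le_coe_toNNReal C)
  have hLip : LipschitzOnWith K q B :=
    (convex_closedBall 0 1).lipschitzOnWith_of_nnnorm_hasFDerivWithin_le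
      (fun x _ => (hqA x).hasFDerivWithinAt) hAK
  -- determinants near the identity are positive
  have hdet : Continuous fun A : E →L[ℝ] E => A.det := ContinuousLinearMap.continuous_det
  obtain ⟨η, hη, hηdet⟩ : ∃ η > 0, ∀ A : E →L[ℝ] E, ‖A‖ < η → 0 < (1 + A).det := by
    have hc : Continuous fun A : E →L[ℝ] E => (1 + A).det :=
      hdet.comp (continuous_const.add continuous_id)
    have h0 : (0 : ℝ) < (1 + (0 : E →L[ℝ] E)).det := by
      rw [add_zero]; simp [ContinuousLinearMap.det]
    have := (hc.tendsto 0).eventually (lt_mem_nhds h0)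
    obtain ⟨η, hη, h⟩ := Metric.eventually_nhds_iff.1 this
    exact ⟨η, hη, fun A hA => h (by simpa using hA)⟩
  set δ : ℝ := min 1 (min 1 η / (K + 1) / 2) with hδ
  have hKpos : (0 : ℝ) < K + 1 := by positivity
  have hδ0 : 0 < δ := by positivity
  have hδK : δ * K < min 1 η := by
    have h2 : δ ≤ min 1 η / (K + 1) / 2 := min_le_right _ _
    have h3 : δ * (K + 1) ≤ min 1 η / 2 := by
      calc δ * (K + 1) ≤ min 1 η / (K + 1) / 2 * (K + 1) := by gcongr
        _ = _ := by field_simp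
    have h4 : 0 < min 1 η := lt_min one_pos hη
    nlinarith
  set f : ℝ → ℝ := fun t => ∫ x in B, (1 + t • A x).det ∂μ with hf
  have hcont : ∀ t : ℝ, Continuous fun x => (1 + t • A x).det := fun t =>
    hdet.comp (continuous_const.add (hAc.const_smul t))
  have hconst : ∀ t, 0 ≤ t → t ≤ δ → f t = μ.real B := by
    intro t ht0 htδ
    have htK : t * K < min 1 η := lt_of_le_of_lt (by gcongr) hδK
    have hmaps : ∀ x ∈ B, x + t • q x ∈ B := by
      intro x hx
      have hx' : ‖x‖ ≤ 1 := by simpa [hB] using hx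
      have ht1 : t ≤ 1 := htδ.trans (min_le_left _ _)
      have : x + t • q x = (1 - t) • x + t • r x := by
        simp only [q, smul_sub, sub_smul, one_smul]; abel
      rw [this, hB, mem_closedBall_zero_iff]
      refine (norm_add_le _ _).trans ?_
      rw [norm_smul, norm_smul, h1, Real.norm_of_nonneg ht0, Real.norm_of_nonneg (by linarith)]
      nlinarith [norm_nonneg x]
    obtain ⟨hinj, himg⟩ := injOn_image_closedBall hLip hq0 ht0
      (htK.trans_le (min_le_left _ _)) hmaps
    have hder : ∀ x ∈ B, HasFDerivWithinAt (fun x => x + t • q x) (1 + t • A x) B x := fun x _ =>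
      ((hasFDerivAt_id x).add ((hqA x).const_smul t)).hasFDerivWithinAt
    have := integral_image_eq_integral_abs_det_fderiv_smul μ hBc.measurableSet hder hinj
      (fun _ => (1 : ℝ))
    rw [himg] at this
    rw [setIntegral_const, smul_eq_mul, mul_one] at this
    rw [this]
    refine setIntegral_congr_fun hBc.measurableSet fun x hx => ?_
    have : 0 < (1 + t • A x).det := by
      apply hηdet
      rw [norm_smul, Real.norm_of_nonneg ht0]
      refine lt_of_le_of_lt ?_ (htK.trans_le (min_le_right _ _))
      gcongr
      exact hAK x hx
    simp only [abs_of_pos this, smul_eq_mul, mul_one]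
  obtain ⟨c, hc1, hc⟩ := exists_det_one_add_eq_sum (E := E) (fun i : ℕ => δ / (i + 1)) (by
    intro i j hij
    simp only at hij
    rw [div_eq_div_iff (by positivity) (by positivity)] at hij
    have := mul_left_cancel₀ hδ0.ne' hij
    exact_mod_cast (add_right_cancel this).symm)
  have hf1 : f 1 = μ.real B := by
    have h2 : f 1 = ∑ i ∈ Finset.range (Module.finrank ℝ E + 1), c i * f (δ / (i + 1)) := by
      simp only [hf, one_smul, ← integral_const_mul]
      rw [← integral_finsetSum]
      · exact integral_congr_ae (Filter.Eventually.of_forall fun x => hc (A x))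
      intro i _
      exact ((continuous_const.mul (hcont _)).continuousOn.integrableOn_compact hBc)
    rw [h2, ← one_mul (μ.real B), ← hc1, Finset.sum_mul]
    refine Finset.sum_congr rfl fun i _ => ?_
    rw [hconst _ (by positivity)]
    exact div_le_self hδ0.le (by linarith [Nat.cast_nonneg (α := ℝ) i])
  -- the derivative of `r` takes values in the orthogonal complement of `r x`
  have hf1' : f 1 = 0 := by
    have : ∀ x, (1 + (1 : ℝ) • A x).det = 0 := by
      intro x
      by_contra hne
      have hrd : HasFDerivAt r (1 + A x) x := by
        have := (hasFDerivAt_id (𝕜 := ℝ) x).add (hqA x)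
        refine this.congr_of_eventuallyEq (Filter.Eventually.of_forall fun y => ?_)
        simp [q]
      rw [one_smul] at hne
      have hort : ∀ v, inner ℝ (r x) ((1 + A x) v) = 0 := by
        intro v
        have h3 : HasFDerivAt (fun y => ‖r y‖ ^ 2) (2 • (innerSL ℝ (r x)).comp (1 + A x)) x :=
          hrd.norm_sq
        have h4 : HasFDerivAt (fun y => ‖r y‖ ^ 2) (0 : E →L[ℝ] ℝ) x := by
          simp only [h1]; exact hasFDerivAt_const _ _
        have h5 := h3.unique h4
        have h6 := congrArg (fun T : E →L[ℝ] ℝ => T v) h5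
        simp only [smul_apply, ContinuousLinearMap.comp_apply, innerSL_apply_apply,
          zero_apply, nsmul_eq_mul, Nat.cast_ofNat] at h6
        linarith
      have hsurj : Function.Surjective ((1 + A x : E →L[ℝ] E) : E →ₗ[ℝ] E) := by
        have hu : IsUnit ((1 + A x : E →L[ℝ] E) : E →ₗ[ℝ] E) := by
          rw [LinearMap.isUnit_iff_isUnit_det]
          exact isUnit_iff_ne_zero.2 hne
        exact ((Module.End.isUnit_iff _).1 hu).2
      obtain ⟨v, hv⟩ := hsurj (r x)
      have h7 := hort v
      have hv' : (1 + A x) v = r x := hv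
      rw [hv', real_inner_self_eq_norm_sq, h1] at h7
      norm_num at h7
    simp only [hf, this, integral_zero]
  have hpos : 0 < μ.real B := by
    rw [Measure.real, ENNReal.toReal_pos_iff]
    exact ⟨measure_closedBall_pos μ _ one_pos, hBc.measure_lt_top⟩
  linarith

/-- A consequence of Brouwer's fixed point theorem: a continuous map of the closed unit ball that
moves no point by more than `1` has a zero. -/
lemma exists_eq_zero_of_norm_sub_le {E : Type*} [NormedAddCommGroup E] [InnerProductSpace ℝ E]
    [FiniteDimensional ℝ E] {H : E → E} (hH : ContinuousOn H (closedBall 0 1))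
    (h1 : ∀ x ∈ closedBall (0 : E) 1, ‖H x - x‖ ≤ 1) : ∃ x ∈ closedBall (0 : E) 1, H x = 0 := by
  by_contra! hne
  -- `w` agrees with `H` on the unit ball, with the identity off the ball of radius `2`
  set p : E → E := fun x => (max 1 ‖x‖)⁻¹ • x with hp
  have hmax : ∀ x : E, 0 < max 1 ‖x‖ := fun x => lt_of_lt_of_le one_pos (le_max_left _ _)
  have hpc : Continuous p :=
    (Continuous.inv₀ (by fun_prop) fun x => (hmax x).ne').smul continuous_id
  have hpB : ∀ x, p x ∈ closedBall (0 : E) 1 := fun x => by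
    rw [mem_closedBall_zero_iff, norm_smul, norm_inv, Real.norm_of_nonneg (hmax x).le,
      inv_mul_le_one₀ (hmax x)]
    exact le_max_right _ _
  have hpid : ∀ x, ‖x‖ ≤ 1 → p x = x := fun x hx => by simp [hp, max_eq_left hx]
  set χ : E → ℝ := fun x => max 0 (min 1 (2 - ‖x‖)) with hχ
  have hχc : Continuous χ := by fun_prop
  set w : E → E := fun x => x - χ x • (p x - H (p x)) with hw
  have hHp : Continuous fun x => H (p x) :=
    hH.comp_continuous hpc hpB
  have hwc : Continuous w := continuous_id.sub (hχc.smul (hpc.sub hHp))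
  have hwne : ∀ x, w x ≠ 0 := by
    intro x
    rcases le_or_gt ‖x‖ 1 with hx | hx
    · have : χ x = 1 := by
        have : min 1 (2 - ‖x‖) = 1 := min_eq_left (by linarith)
        simp [hχ, this]
      simp only [hw, this, hpid x hx, one_smul, sub_sub_cancel]
      exact hne x (by simpa using hx)
    · intro h0
      have hx0 : x = χ x • (p x - H (p x)) := sub_eq_zero.1 h0
      have hχ1 : |χ x| ≤ 1 := by
        rw [abs_of_nonneg (le_max_left _ _)]
        exact max_le zero_le_one (min_le_left _ _)
      have h2 : ‖χ x • (p x - H (p x))‖ ≤ 1 := by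
        rw [norm_smul, Real.norm_eq_abs, norm_sub_rev]
        exact mul_le_one₀ hχ1 (norm_nonneg _) (h1 _ (hpB x))
      rw [← hx0] at h2
      linarith
  have hwid : ∀ x, 2 ≤ ‖x‖ → w x = x := by
    intro x hx
    have : χ x = 0 := max_eq_left ((min_le_right _ _).trans (by linarith))
    simp [hw, this]
  obtain ⟨g, hgC, hgw, hgS, -⟩ := hwc.exists_contDiff_approx_and_eqOn 1
    (ε := fun x => ‖w x‖) hwc.norm (fun x => norm_pos_iff.2 (hwne x))
    (S := {x | 3 ≤ ‖x‖}) (U := {x | 2 < ‖x‖}) (isClosed_le continuous_const continuous_norm)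
    ((isOpen_lt continuous_const continuous_norm).mem_nhdsSet.2 fun x (hx : 3 ≤ ‖x‖) =>
      show 2 < ‖x‖ by linarith)
    (contDiffOn_id.congr fun x (hx : 2 < ‖x‖) => hwid x hx.le)
  have hgne : ∀ x, g x ≠ 0 := fun x h0 => by
    have := hgw x
    rw [h0, dist_zero_left] at this
    exact lt_irrefl _ this
  have hgC3 : ContDiff ℝ 1 fun x => g ((3 : ℝ) • x) := by
    have : ContDiff ℝ 1 g := by simpa using hgC
    exact this.comp (contDiff_const.smul contDiff_id)
  refine not_exists_contDiff_retraction (fun x => ‖g ((3 : ℝ) • x)‖⁻¹ • g ((3 : ℝ) • x)) ?_ ?_ ?_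
  · exact ((hgC3.norm ℝ fun x => hgne _).inv fun x => norm_ne_zero_iff.2 (hgne _)).smul hgC3
  · intro x
    exact norm_smul_inv_norm (𝕜 := ℝ) (hgne _)
  · intro x hx
    have h3 : ‖(3 : ℝ) • x‖ = 3 := by rw [norm_smul, hx]; norm_num
    have : g ((3 : ℝ) • x) = (3 : ℝ) • x := by
      rw [hgS (show 3 ≤ ‖(3 : ℝ) • x‖ from h3.ge), hwid _ (by rw [h3]; norm_num)]
    simp only [this, h3, smul_smul]
    norm_num

/-- Invariance of domain for the unit ball, following Tao: a continuous left inverse `G` of `f` has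
a zero at `f 0`; were `f 0` not interior to the image of the ball, `G` could be perturbed on the
image so as to have no zero there. -/
lemma image_closedBall_mem_nhds {E : Type*} [NormedAddCommGroup E] [InnerProductSpace ℝ E]
    [FiniteDimensional ℝ E] {f : E → E} (hf : ContinuousOn f (closedBall 0 1))
    (hinj : InjOn f (closedBall 0 1)) : f '' closedBall 0 1 ∈ 𝓝 (f 0) := by
  by_contra hnot
  borelize E
  let μ : Measure E := volume
  set B := closedBall (0 : E) 1 with hB
  have hBc : IsCompact B := isCompact_closedBall 0 1
  have h0B : (0 : E) ∈ B := by simp [hB]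
  set K := f '' B with hK
  have hKc : IsCompact K := hBc.image_of_continuousOn hf
  have : CompactSpace B := isCompact_iff_compactSpace.1 hBc
  have hemb : IsClosedEmbedding (B.domRestrict f) :=
    (continuousOn_iff_continuous_domRestrict.1 hf).isClosedEmbedding (injOn_iff_injective.1 hinj)
  obtain ⟨G, hG⟩ := ContinuousMap.exists_extension hemb
    ⟨(Subtype.val : B → E), continuous_subtype_val⟩
  have hGf : ∀ x ∈ B, G (f x) = x := fun x hx => congrArg (fun T : C(B, E) => T ⟨x, hx⟩) hG
  have hG0 : G (f 0) = 0 := hGf 0 h0B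
  obtain ⟨ε, hε, hGε⟩ : ∃ ε > 0, ∀ y, dist y (f 0) ≤ 2 * ε → ‖G y‖ ≤ 1 / 10 := by
    have h1 : ∀ᶠ y in 𝓝 (f 0), ‖G y‖ < 1 / 10 := by
      have : Filter.Tendsto (fun y => ‖G y‖) (𝓝 (f 0)) (𝓝 ‖G (f 0)‖) :=
        (G.continuous.norm).tendsto _
      rw [hG0, norm_zero] at this
      exact this.eventually (gt_mem_nhds (by norm_num))
    obtain ⟨ε, hε, h⟩ := Metric.eventually_nhds_iff.1 h1
    exact ⟨ε / 3, by positivity, fun y hy => (h (by linarith)).le⟩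
  obtain ⟨c, hcK, hc⟩ : ∃ c, c ∉ K ∧ dist c (f 0) < ε := by
    by_contra! hall
    refine hnot (Filter.mem_of_superset (ball_mem_nhds _ hε) fun y hy => ?_)
    by_contra hyK
    exact absurd (hall y hyK) (not_le.2 hy)
  have hnorm : ∀ y ∈ K, 0 < ‖y - c‖ := fun y hy =>
    norm_pos_iff.2 (sub_ne_zero.2 fun h => hcK (h ▸ hy))
  -- push the part of the image within `ε` of `c` radially onto the sphere of radius `ε`
  set Φ : E → E := fun y => c + max (ε / ‖y - c‖) 1 • (y - c) with hΦ
  have hΦc : ContinuousOn Φ K := by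
    refine continuousOn_const.add (ContinuousOn.smul (ContinuousOn.sup ?_ continuousOn_const) ?_)
    · exact continuousOn_const.div (by fun_prop) fun y hy => (hnorm y hy).ne'
    · fun_prop
  have hΦfar : ∀ y ∈ K, ε ≤ ‖y - c‖ → Φ y = y := fun y hy h => by
    have : max (ε / ‖y - c‖) 1 = 1 := max_eq_right ((div_le_one (hnorm y hy)).2 h)
    simp [hΦ, this]
  have hΦnear : ∀ y ∈ K, ‖y - c‖ ≤ ε → Φ y ∈ sphere c ε := fun y hy h => by
    have : max (ε / ‖y - c‖) 1 = ε / ‖y - c‖ := max_eq_left ((one_le_div (hnorm y hy)).2 h)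
    rw [mem_sphere_iff_norm]
    simp only [hΦ, this, add_sub_cancel_left, norm_smul, norm_div, norm_norm,
      Real.norm_of_nonneg hε.le]
    rw [div_mul_cancel₀ _ (hnorm y hy).ne']
  have hKεc : IsCompact (K ∩ {y | ε ≤ ‖y - c‖}) :=
    hKc.inter_right (isClosed_le continuous_const (by fun_prop))
  obtain ⟨δ₀, hδ₀, hδG⟩ := hKεc.exists_forall_le' (f := fun y => ‖G y‖) (a := 0)
    G.continuous.norm.continuousOn (by
      rintro _ ⟨⟨x, hx, rfl⟩, hxc⟩
      rw [hGf x hx, norm_pos_iff]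
      rintro rfl
      have : ε ≤ ‖f 0 - c‖ := hxc
      rw [← dist_eq_norm, dist_comm] at this
      linarith)
  set δ := min δ₀ (1 / 10) with hδ
  have hδpos : 0 < δ := lt_min hδ₀ (by norm_num)
  obtain ⟨P, hPC, hPG, -⟩ := G.continuous.exists_contDiff_approx 1 (ε := fun _ => δ / 2)
    continuous_const (fun _ => by positivity)
  -- a smooth image of the sphere is a null set, so a small translation makes it avoid the origin
  have hnull : μ (P '' sphere c ε) = 0 :=
    addHaar_image_eq_zero_of_differentiableOn_of_addHaar_eq_zero μ
      (hPC.differentiable (by simp)).differentiableOn (Measure.addHaar_sphere_of_ne_zero μ c hε.ne')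
  obtain ⟨v, hv, hvP⟩ : ∃ v ∈ ball (0 : E) (δ / 2), v ∉ P '' sphere c ε := by
    by_contra! hall
    have h1 : μ (ball (0 : E) (δ / 2)) ≤ 0 := hnull ▸ measure_mono hall
    exact absurd (measure_ball_pos μ (0 : E) (half_pos hδpos)) (not_lt.2 h1)
  have hv' : ‖v‖ < δ / 2 := by simpa using hv
  have hPv : ∀ y, ‖P y - v - G y‖ < δ := fun y => by
    have h1 := hPG y
    rw [dist_eq_norm] at h1
    calc ‖P y - v - G y‖ = ‖(P y - G y) - v‖ := by congr 1; abel
      _ ≤ ‖P y - G y‖ + ‖v‖ := norm_sub_le _ _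
      _ < δ := by linarith
  obtain ⟨x, hx, hx0⟩ := exists_eq_zero_of_norm_sub_le (H := fun x => P (Φ (f x)) - v)
    ((hPC.continuous.comp_continuousOn (hΦc.comp hf fun x hx => mem_image_of_mem f hx)).sub
      continuousOn_const) (by
      intro x hx
      have hxK : f x ∈ K := mem_image_of_mem f hx
      have hδ1 : δ ≤ 1 / 10 := min_le_right _ _
      rcases le_total ε ‖f x - c‖ with h | h
      · have h2 := hPv (f x)
        rw [hGf x hx] at h2
        rw [hΦfar _ hxK h]
        linarith
      · have h2 := hPv (Φ (f x))
        have h3 : ‖G (Φ (f x))‖ ≤ 1 / 10 := hGε _ (by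
          have : dist (Φ (f x)) c = ε := hΦnear _ hxK h
          linarith [dist_triangle (Φ (f x)) c (f 0)])
        have h4 : ‖G (f x)‖ ≤ 1 / 10 := hGε _ (by
          have : dist (f x) c ≤ ε := by rwa [dist_eq_norm]
          linarith [dist_triangle (f x) c (f 0)])
        rw [hGf x hx] at h4
        calc ‖P (Φ (f x)) - v - x‖ = ‖(P (Φ (f x)) - v - G (Φ (f x))) + G (Φ (f x)) - x‖ := by
              congr 1; abel
          _ ≤ ‖(P (Φ (f x)) - v - G (Φ (f x))) + G (Φ (f x))‖ + ‖x‖ := norm_sub_le _ _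
          _ ≤ ‖P (Φ (f x)) - v - G (Φ (f x))‖ + ‖G (Φ (f x))‖ + ‖x‖ := by
              gcongr; exact norm_add_le _ _
          _ ≤ 1 := by linarith)
  have hxK : f x ∈ K := mem_image_of_mem f hx
  rcases le_total ε ‖f x - c‖ with h | h
  · have h2 := hPv (f x)
    have h3 := hδG (f x) ⟨hxK, h⟩
    have hx1 : P (Φ (f x)) - v = 0 := hx0
    rw [hΦfar _ hxK h] at hx1
    rw [hx1, zero_sub, norm_neg] at h2
    exact absurd (h2.trans_le (min_le_left _ _)) (not_lt.2 h3)
  · exact hvP ⟨Φ (f x), hΦnear _ hxK h, sub_eq_zero.1 hx0⟩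

/-- **Invariance of domain**: a continuous injective map from an open subset of a Euclidean space to
that space is open. -/
theorem isOpen_image {E : Type*} [NormedAddCommGroup E] [InnerProductSpace ℝ E]
    [FiniteDimensional ℝ E] {U : Set E} (hU : IsOpen U) {f : E → E} (hf : ContinuousOn f U)
    (hinj : InjOn f U) : IsOpen (f '' U) := by
  rw [isOpen_iff_mem_nhds]
  rintro _ ⟨x, hx, rfl⟩
  obtain ⟨ρ, hρ, hρU⟩ := Metric.nhds_basis_closedBall.mem_iff.1 (hU.mem_nhds hx)
  have hmaps : MapsTo (fun y : E => x + ρ • y) (closedBall 0 1) U := by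
    intro y hy
    apply hρU
    rw [mem_closedBall_iff_norm, add_sub_cancel_left, norm_smul, Real.norm_of_nonneg hρ.le]
    exact mul_le_of_le_one_right hρ.le (by simpa using hy)
  have h1 := image_closedBall_mem_nhds (f := fun y => f (x + ρ • y))
    (hf.comp (by fun_prop) hmaps) (by
      intro y hy z hz hyz
      have := hinj (hmaps hy) (hmaps hz) hyz
      exact smul_right_injective E hρ.ne' (add_left_cancel this))
  rw [smul_zero, add_zero] at h1
  refine Filter.mem_of_superset h1 ?_
  rintro _ ⟨y, hy, rfl⟩
  exact ⟨_, hmaps hy, rfl⟩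

end InvarianceOfDomain

namespace MetricEnd

/-! ### Invariance of domain on manifolds with boundary -/

lemma mem_halfSpace_succ {k : ℕ} {x : EuclideanSpace ℝ (Fin (k + 1))} :
    x ∈ halfSpace (k + 1) ↔ 0 ≤ x (Fin.last k) := by
  constructor
  · intro h
    exact h (Fin.last k) (by simp)
  · intro h i hi
    have : i = Fin.last k := Fin.ext (by simpa using hi)
    rwa [this]

/-- The vector `x` with its last coordinate replaced by `a`. -/
noncomputable def setLast {k : ℕ} (x : EuclideanSpace ℝ (Fin (k + 1))) (a : ℝ) :
    EuclideanSpace ℝ (Fin (k + 1)) :=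
  WithLp.toLp 2 (Function.update (fun i => x i) (Fin.last k) a)

@[simp]
lemma setLast_last {k : ℕ} (x : EuclideanSpace ℝ (Fin (k + 1))) (a : ℝ) :
    setLast x a (Fin.last k) = a := by
  simp [setLast]

@[simp]
lemma setLast_setLast {k : ℕ} (x : EuclideanSpace ℝ (Fin (k + 1))) (a b : ℝ) :
    setLast (setLast x a) b = setLast x b := by
  ext i
  by_cases hi : i = Fin.last k
  · subst hi; simp
  · simp [setLast, hi]

@[simp]
lemma setLast_self {k : ℕ} (x : EuclideanSpace ℝ (Fin (k + 1))) :
    setLast x (x (Fin.last k)) = x := by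
  ext i
  simp [setLast]

lemma continuous_setLast {X : Type*} [TopologicalSpace X] {k : ℕ}
    {f : X → EuclideanSpace ℝ (Fin (k + 1))} {a : X → ℝ} (hf : Continuous f) (ha : Continuous a) :
    Continuous fun x => setLast (f x) (a x) := by
  refine (PiLp.continuous_toLp 2 _).comp ?_
  exact Continuous.update (by fun_prop) _ ha

/-- The map of `ℝⁿ` to the half space that folds `ℝⁿ` along the boundary hyperplane. -/
noncomputable def fold {k : ℕ} (x : EuclideanSpace ℝ (Fin (k + 1))) : halfSpace (k + 1) :=
  ⟨setLast x |x (Fin.last k)|, by rw [mem_halfSpace_succ]; simp⟩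

lemma continuous_fold {k : ℕ} : Continuous (fold (k := k)) :=
  (continuous_setLast continuous_id (by fun_prop)).subtype_mk _

lemma coe_fold_of_nonneg {k : ℕ} {x : EuclideanSpace ℝ (Fin (k + 1))} (hx : 0 ≤ x (Fin.last k)) :
    (fold x : EuclideanSpace ℝ (Fin (k + 1))) = x := by
  simp [fold, abs_of_nonneg hx]

lemma fold_coe {k : ℕ} (z : halfSpace (k + 1)) :
    fold (z : EuclideanSpace ℝ (Fin (k + 1))) = z :=
  Subtype.ext (coe_fold_of_nonneg (mem_halfSpace_succ.1 z.2))

/-- The reflection of `ℝⁿ` in the boundary hyperplane of the half space. -/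
noncomputable def reflectLast {k : ℕ} (x : EuclideanSpace ℝ (Fin (k + 1))) :
    EuclideanSpace ℝ (Fin (k + 1)) :=
  setLast x (-x (Fin.last k))

lemma reflectLast_reflectLast {k : ℕ} (x : EuclideanSpace ℝ (Fin (k + 1))) :
    reflectLast (reflectLast x) = x := by
  simp [reflectLast]

lemma reflectLast_coe_fold {k : ℕ} {x : EuclideanSpace ℝ (Fin (k + 1))}
    (hx : x (Fin.last k) ≤ 0) :
    reflectLast (fold x : EuclideanSpace ℝ (Fin (k + 1))) = x := by
  simp [reflectLast, fold, abs_of_nonpos hx]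

/-- The inclusion of the open half space into `ℝⁿ` as a chart of the closed half space. -/
noncomputable def openHalfChart (k : ℕ) :
    OpenPartialHomeomorph (halfSpace (k + 1)) (EuclideanSpace ℝ (Fin (k + 1))) where
  toFun := Subtype.val
  invFun := fold
  source := {z | 0 < (z : EuclideanSpace ℝ (Fin (k + 1))) (Fin.last k)}
  target := {z | 0 < z (Fin.last k)}
  map_source' := fun _ hz => hz
  map_target' := fun z (hz : 0 < z (Fin.last k)) => by
    simpa [coe_fold_of_nonneg hz.le] using hz
  left_inv' := fun z _ => fold_coe z
  right_inv' := fun z (hz : 0 < z (Fin.last k)) => coe_fold_of_nonneg hz.le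
  open_source := isOpen_lt continuous_const (by fun_prop)
  open_target := isOpen_lt continuous_const (by fun_prop)
  continuousOn_toFun := continuous_subtype_val.continuousOn
  continuousOn_invFun := continuous_fold.continuousOn

/-- Invariance of the boundary: in a chart the boundary points of a manifold are those of the half
space. -/
lemma symm_mem_manifoldBoundary_iff {L : Type*} [TopologicalSpace L] {k : ℕ}
    (e : OpenPartialHomeomorph L (halfSpace (k + 1))) {z : halfSpace (k + 1)} (hz : z ∈ e.target) :
    e.symm z ∈ manifoldBoundary (k + 1) L ↔
      (z : EuclideanSpace ℝ (Fin (k + 1))) (Fin.last k) = 0 := by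
  constructor
  · intro hb
    by_contra hne
    have hpos : 0 < (z : EuclideanSpace ℝ (Fin (k + 1))) (Fin.last k) :=
      lt_of_le_of_ne (mem_halfSpace_succ.1 z.2) (Ne.symm hne)
    refine hb ⟨e.trans (openHalfChart k), ?_⟩
    rw [OpenPartialHomeomorph.trans_source]
    refine ⟨e.map_target hz, ?_⟩
    rw [mem_preimage, e.right_inv hz]
    exact hpos
  · rintro h0 ⟨c, hc⟩
    set O := c.target ∩ c.symm ⁻¹' e.source with hO
    have hOo : IsOpen O := c.symm.isOpen_inter_preimage e.open_source
    have hopen := InvarianceOfDomain.isOpen_image hOo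
      (f := fun w => (e (c.symm w) : EuclideanSpace ℝ (Fin (k + 1))))
      (continuous_subtype_val.comp_continuousOn
        (e.continuousOn.comp (c.symm.continuousOn.mono inter_subset_left) fun w hw => hw.2))
      (by
        intro w hw w' hw' h
        exact c.symm.injOn hw.1 hw'.1 (e.injOn hw.2 hw'.2 (Subtype.ext h)))
    have hmem : (z : EuclideanSpace ℝ (Fin (k + 1))) ∈
        (fun w => (e (c.symm w) : EuclideanSpace ℝ (Fin (k + 1)))) '' O := by
      refine ⟨c (e.symm z), ⟨c.map_source hc, ?_⟩, ?_⟩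
      · rw [mem_preimage, c.left_inv hc]; exact e.map_target hz
      · simp only [c.left_inv hc, e.right_inv hz]
    have hcont : Continuous fun t : ℝ => setLast (z : EuclideanSpace ℝ (Fin (k + 1))) t :=
      continuous_setLast continuous_const continuous_id
    have hev : ∀ᶠ t in 𝓝 (0 : ℝ), setLast (z : EuclideanSpace ℝ (Fin (k + 1))) t ∈
        (fun w => (e (c.symm w) : EuclideanSpace ℝ (Fin (k + 1)))) '' O := by
      refine (hcont.tendsto 0).eventually (hopen.mem_nhds ?_)
      rwa [← h0, setLast_self]
    obtain ⟨δ, hδ, hball⟩ := Metric.eventually_nhds_iff.1 hev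
    obtain ⟨w, -, hw⟩ := hball (y := -(δ / 2)) (by
      rw [dist_zero_right, norm_neg, Real.norm_of_nonneg (by positivity)]; linarith)
    have h1 := mem_halfSpace_succ.1 (e (c.symm w)).2
    simp only at hw
    rw [hw, setLast_last] at h1
    linarith

/-- **Invariance of domain** for manifolds with boundary: a continuous injection of an open subset
that respects the boundary is open. Near a boundary point the map is extended by reflection to an
open subset of Euclidean space. -/
theorem isOpen_image_of_mem_manifoldBoundary_iff {L : Type*} [TopologicalSpace L] {k : ℕ}
    (hL : IsManifoldWithBoundary (k + 1) L) {U : Set L} (hU : IsOpen U) {G : L → L}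
    (hG : ContinuousOn G U) (hinj : InjOn G U)
    (hb : ∀ x ∈ U, G x ∈ manifoldBoundary (k + 1) L ↔ x ∈ manifoldBoundary (k + 1) L) :
    IsOpen (G '' U) := by
  rw [isOpen_iff_mem_nhds]
  rintro _ ⟨x, hx, rfl⟩
  obtain ⟨e, hxe⟩ := hL.chart x
  obtain ⟨e', hxe'⟩ := hL.chart (G x)
  set W := U ∩ G ⁻¹' e'.source with hW
  have hWo : IsOpen W := hG.isOpen_inter_preimage hU e'.open_source
  set V := e.target ∩ e.symm ⁻¹' W with hV
  have hVo : IsOpen V := e.symm.isOpen_inter_preimage hWo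
  set γ : halfSpace (k + 1) → EuclideanSpace ℝ (Fin (k + 1)) := fun z => e' (G (e.symm z)) with hγ
  have hγc : ContinuousOn γ V := by
    refine continuous_subtype_val.comp_continuousOn
      (e'.continuousOn.comp (t := e'.source) ?_ fun z hz => hz.2.2)
    exact hG.comp (e.symm.continuousOn.mono inter_subset_left) fun z hz => hz.2.1
  have hγinj : InjOn γ V := by
    intro z hz w hw h
    exact e.symm.injOn hz.1 hw.1 (hinj hz.2.1 hw.2.1 (e'.injOn hz.2.2 hw.2.2 (Subtype.ext h)))
  have hγ0 : ∀ z, 0 ≤ γ z (Fin.last k) := fun z => mem_halfSpace_succ.1 (e' (G (e.symm z))).2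
  have hγb : ∀ z ∈ V, γ z (Fin.last k) = 0 ↔
      (z : EuclideanSpace ℝ (Fin (k + 1))) (Fin.last k) = 0 := by
    intro z hz
    have h1 := symm_mem_manifoldBoundary_iff e hz.1
    have h2 := symm_mem_manifoldBoundary_iff e' (e'.map_source hz.2.2)
    rw [e'.left_inv hz.2.2] at h2
    rw [← h1, ← hb _ hz.2.1, h2]
  have hfl : ∀ z : EuclideanSpace ℝ (Fin (k + 1)),
      (fold z : EuclideanSpace ℝ (Fin (k + 1))) (Fin.last k) = |z (Fin.last k)| := fun z => by
    simp [fold]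
  have hrc : Continuous (reflectLast (k := k)) := continuous_setLast continuous_id (by fun_prop)
  set g : EuclideanSpace ℝ (Fin (k + 1)) → EuclideanSpace ℝ (Fin (k + 1)) := fun z =>
    if 0 ≤ z (Fin.last k) then γ (fold z) else reflectLast (γ (fold z)) with hg
  have hgpos : ∀ z, 0 ≤ z (Fin.last k) → g z = γ (fold z) := fun z hz => if_pos hz
  have hgneg : ∀ z, z (Fin.last k) < 0 → g z = reflectLast (γ (fold z)) :=
    fun z hz => if_neg (not_le.2 hz)
  have hγf : ContinuousOn (fun z => γ (fold z)) (fold ⁻¹' V) :=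
    hγc.comp continuous_fold.continuousOn fun z hz => hz
  have hgc : ContinuousOn g (fold ⁻¹' V) := by
    refine ContinuousOn.if ?_ (hγf.mono inter_subset_left)
      ((hrc.comp_continuousOn hγf).mono inter_subset_left)
    rintro z ⟨hz, hz0⟩
    have h0 : (0 : ℝ) = z (Fin.last k) :=
      frontier_le_subset_eq (f := fun _ : EuclideanSpace ℝ (Fin (k + 1)) => (0 : ℝ))
        (g := fun z => z (Fin.last k)) continuous_const (by fun_prop) hz0
    have h1 : γ (fold z) (Fin.last k) = 0 := (hγb _ hz).2 (by rw [hfl, ← h0, abs_zero])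
    have h2 : -γ (fold z) (Fin.last k) = γ (fold z) (Fin.last k) := by rw [h1, neg_zero]
    rw [reflectLast, h2, setLast_self]
  -- the sign of the last coordinate is preserved
  have hneg : ∀ z ∈ fold ⁻¹' V, z (Fin.last k) < 0 → g z (Fin.last k) < 0 := by
    intro z hz h
    rw [hgneg z h, reflectLast, setLast_last, neg_lt_zero]
    refine lt_of_le_of_ne (hγ0 _) fun h0 => ?_
    have := (hγb _ hz).1 h0.symm
    rw [hfl, abs_eq_zero] at this
    exact h.ne this
  have hpos : ∀ z, 0 ≤ z (Fin.last k) → 0 ≤ g z (Fin.last k) := fun z h => by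
    rw [hgpos z h]; exact hγ0 _
  have hginj : InjOn g (fold ⁻¹' V) := by
    intro z hz w hw h
    rcases le_or_gt 0 (z (Fin.last k)) with h1 | h1 <;>
      rcases le_or_gt 0 (w (Fin.last k)) with h2 | h2
    · rw [hgpos z h1, hgpos w h2] at h
      rw [← coe_fold_of_nonneg h1, ← coe_fold_of_nonneg h2, hγinj hz hw h]
    · exact absurd (h ▸ hpos z h1) (not_le.2 (hneg w hw h2))
    · exact absurd (h ▸ hneg z hz h1) (not_lt.2 (hpos w h2))
    · rw [hgneg z h1, hgneg w h2] at h
      have h3 := congrArg reflectLast h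
      rw [reflectLast_reflectLast, reflectLast_reflectLast] at h3
      rw [← reflectLast_coe_fold h1.le, ← reflectLast_coe_fold h2.le, hγinj hz hw h3]
  have hopen := InvarianceOfDomain.isOpen_image (hVo.preimage continuous_fold) hgc hginj
  have hO : IsOpen (e'.source ∩ e' ⁻¹' (Subtype.val ⁻¹' (g '' (fold ⁻¹' V)))) :=
    e'.isOpen_inter_preimage (hopen.preimage continuous_subtype_val)
  refine Filter.mem_of_superset (hO.mem_nhds ⟨hxe', ?_⟩) ?_
  · refine ⟨(e x : EuclideanSpace ℝ (Fin (k + 1))), ?_, ?_⟩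
    · rw [mem_preimage, fold_coe]
      refine ⟨e.map_source hxe, ?_⟩
      rw [mem_preimage, e.left_inv hxe]
      exact ⟨hx, hxe'⟩
    · rw [hgpos _ (mem_halfSpace_succ.1 (e x).2), fold_coe]
      simp only [hγ, e.left_inv hxe]
  · rintro y ⟨hy, z, hz, hzy⟩
    have hz0 : 0 ≤ z (Fin.last k) := by
      by_contra hlt
      have := hneg z hz (not_le.1 hlt)
      rw [hzy] at this
      exact absurd (mem_halfSpace_succ.1 (e' y).2) (not_le.2 this)
    rw [hgpos z hz0] at hzy
    exact ⟨_, hz.2.1, e'.injOn hz.2.2 hy (Subtype.ext hzy)⟩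

/-! ### Gluing lemmas -/

/-- An isotopy that is fixed off `N` and maps `N` onto open sets at every time has constant range:
a point of `N` that left `h t' '' N` would have to cross the trace of a point off `N`. -/
lemma range_subset_of_isotopy {P L : Type*} [TopologicalSpace L] {h : unitInterval → P → L}
    {N : Set P} (hcont : ∀ x, Continuous fun t => h t x) (hinj : ∀ t, Function.Injective (h t))
    (hfix : ∀ x ∉ N, ∀ t t', h t x = h t' x) (hclosed : ∀ t, IsClosed (range (h t)))
    (hopen : ∀ t, IsOpen (h t '' N)) (t t' : unitInterval) : range (h t) ⊆ range (h t') := by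
  rintro _ ⟨x, rfl⟩
  by_cases hx : x ∈ N
  · have hJ : (fun u => h u x) ⁻¹' (h t' '' N) = (fun u => h u x) ⁻¹' range (h t') := by
      refine Subset.antisymm (preimage_mono (image_subset_range _ _)) ?_
      rintro u ⟨y, hy⟩
      by_cases hyN : y ∈ N
      · exact ⟨y, hyN, hy⟩
      · have : h u y = h u x := (hfix y hyN u t').trans hy
        exact absurd (hinj u this ▸ hx) hyN
    have hclopen : IsClopen ((fun u => h u x) ⁻¹' range (h t')) :=
      ⟨(hclosed t').preimage (hcont x), hJ ▸ (hopen t').preimage (hcont x)⟩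
    have huniv := hclopen.eq_univ ⟨t', mem_range_self x⟩
    exact (huniv ▸ mem_univ t : t ∈ (fun u => h u x) ⁻¹' range (h t'))
  · exact ⟨x, hfix x hx t' t⟩

/-- Uniform continuity can be checked on two pieces if points of the two pieces are close to each
other only near a compact set. -/
lemma uniformContinuous_of_compact_overlap {X Z : Type*} [PseudoMetricSpace X]
    [PseudoMetricSpace Z] {h : X → Z} {P K : Set X} (hc : Continuous h)
    (hP : UniformContinuousOn h P) (hQ : UniformContinuousOn h Pᶜ) (hK : IsCompact K) {δ : ℝ}
    (hδ : 0 < δ) (hPK : ∀ x ∈ P, ∀ y ∉ P, dist x y < δ → x ∈ K ∨ y ∈ K) : UniformContinuous h := by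
  rw [Metric.uniformContinuousOn_iff] at hP hQ
  rw [Metric.uniformContinuous_iff]
  intro ε hε
  obtain ⟨δ₁, hδ₁, h₁⟩ := hP ε hε
  obtain ⟨δ₂, hδ₂, h₂⟩ := hQ ε hε
  have hKu := hK.uniformContinuousAt_of_continuousAt h (fun x _ => hc.continuousAt)
    (Metric.dist_mem_uniformity hε)
  obtain ⟨δ₃, hδ₃, h₃⟩ := Metric.mem_uniformity_dist.1 hKu
  have key : ∀ x ∈ P, ∀ y ∉ P, dist x y < min δ δ₃ → dist (h x) (h y) < ε := by
    intro x hx y hy hxy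
    rcases hPK x hx y hy (hxy.trans_le (min_le_left _ _)) with hxK | hyK
    · exact h₃ (hxy.trans_le (min_le_right _ _)) hxK
    · rw [dist_comm]
      rw [dist_comm] at hxy
      exact h₃ (hxy.trans_le (min_le_right _ _)) hyK
  refine ⟨min (min δ₁ δ₂) (min δ δ₃), by positivity, fun {x y} hxy => ?_⟩
  by_cases hx : x ∈ P <;> by_cases hy : y ∈ P
  · exact h₁ x hx y hy (hxy.trans_le ((min_le_left _ _).trans (min_le_left _ _)))
  · exact key x hx y hy (hxy.trans_le (min_le_right _ _))
  · rw [dist_comm] at hxy ⊢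
    exact key y hy x hx (hxy.trans_le (min_le_right _ _))
  · exact h₂ x hx y hy (hxy.trans_le ((min_le_left _ _).trans (min_le_right _ _)))

/-- A map that is uniformly continuous on the closed set `P` and is the identity on the closure of
its complement is uniformly continuous, if the complement comes close to `P` only near a compact
set. -/
lemma uniformContinuous_of_eqOn_id {X : Type*} [PseudoMetricSpace X] {k : X → X} {P K : Set X}
    (hPc : IsClosed P) (hP : UniformContinuousOn k P) (hid : ∀ x ∈ closure Pᶜ, k x = x)
    (hK : IsCompact K) {δ : ℝ} (hδ : 0 < δ)
    (hPK : ∀ x ∈ P, ∀ y ∉ P, dist x y < δ → x ∈ K ∨ y ∈ K) : UniformContinuous k := by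
  refine uniformContinuous_of_compact_overlap (P := P) (K := K) ?_ hP ?_ hK hδ hPK
  · have h1 : ContinuousOn k (closure Pᶜ) := continuousOn_id.congr hid
    have h2 : P ∪ closure Pᶜ = univ :=
      eq_univ_of_forall fun x => (em (x ∈ P)).imp id fun h => subset_closure h
    rw [← continuousOn_univ, ← h2]
    exact hP.continuousOn.union_of_isClosed h1 hPc isClosed_closure
  · exact uniformContinuous_id.uniformContinuousOn.congr fun x hx =>
      (hid x (subset_closure hx)).symm

/-- A uniform embedding `f` may be replaced on a closed set `P` by another uniform embedding of `P`
that has the same image and agrees with `f` on the frontier of `P`. -/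
lemma isUniformEmbedding_glue {X Z : Type*} [MetricSpace X] [MetricSpace Z] {P K : Set X}
    (hPc : IsClosed P) {f h : X → Z} (hf : IsUniformEmbedding f)
    (hh : IsUniformEmbedding (P.domRestrict h)) (hfh : ∀ x ∈ closure Pᶜ, h x = f x)
    (himg : h '' P = f '' P) (hK : IsCompact K) {δ : ℝ} (hδ : 0 < δ)
    (hPK : ∀ x ∈ P, ∀ y ∉ P, dist x y < δ → x ∈ K ∨ y ∈ K) :
    IsUniformEmbedding h ∧ range h = range f := by
  classical
  have hff : IsUniformEmbedding (P.domRestrict f) :=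
    hf.comp ⟨isUniformInducing_val P, Subtype.val_injective⟩
  -- `k = f⁻¹ ∘ h` and its inverse `k'` permute `P`
  have hψ : ∀ x : X, ∃ y : X, (x ∈ P → y ∈ P) ∧ f y = h x ∧ (x ∉ P → y = x) := by
    intro x
    by_cases hx : x ∈ P
    · obtain ⟨y, hy, hyx⟩ := himg ▸ mem_image_of_mem h hx
      exact ⟨y, fun _ => hy, hyx, fun h => absurd hx h⟩
    · exact ⟨x, fun h => absurd h hx, (hfh x (subset_closure hx)).symm, fun _ => rfl⟩
  have hψ' : ∀ x : X, ∃ y : X, (x ∈ P → y ∈ P) ∧ h y = f x ∧ (x ∉ P → y = x) := by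
    intro x
    by_cases hx : x ∈ P
    · obtain ⟨y, hy, hyx⟩ := himg.symm ▸ mem_image_of_mem f hx
      exact ⟨y, fun _ => hy, hyx, fun h => absurd hx h⟩
    · exact ⟨x, fun h => absurd h hx, hfh x (subset_closure hx), fun _ => rfl⟩
  choose k hkP hk hkid using hψ
  choose k' hkP' hk' hkid' using hψ'
  have hinv : ∀ x, k' (k x) = x := by
    intro x
    by_cases hx : x ∈ P
    · have h1 : h (k' (k x)) = h x := (hk' _).trans (hk x)
      exact congrArg Subtype.val
        (hh.injective (a₁ := ⟨_, hkP' _ (hkP x hx)⟩) (a₂ := ⟨x, hx⟩) h1)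
    · have h1 : k x = x := hkid x hx
      rw [h1, hkid' x hx]
  have hinv' : ∀ x, k (k' x) = x := fun x => hf.injective ((hk _).trans (hk' x))
  have hku : UniformContinuous k := by
    refine uniformContinuous_of_eqOn_id hPc ?_ (fun x hx => ?_) hK hδ hPK
    · rw [uniformContinuousOn_iff_restrict]
      refine hf.isUniformInducing.uniformContinuous_iff.2 ?_
      have : f ∘ P.domRestrict k = P.domRestrict h := funext fun x => hk x
      rw [this]
      exact hh.uniformContinuous
    · exact hf.injective ((hk x).trans (hfh x hx))
  have hku' : UniformContinuous k' := by
    refine uniformContinuous_of_eqOn_id hPc ?_ (fun x hx => ?_) hK hδ hPK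
    · rw [uniformContinuousOn_iff_restrict]
      have h1 : UniformContinuous fun x : P => (⟨k' x, hkP' _ x.2⟩ : P) := by
        refine hh.isUniformInducing.uniformContinuous_iff.2 ?_
        have : (P.domRestrict h ∘ fun x : P => (⟨k' x, hkP' _ x.2⟩ : P)) = P.domRestrict f :=
          funext fun x => hk' x
        rw [this]
        exact hff.uniformContinuous
      exact uniformContinuous_subtype_val.comp h1
    · have h1 : k x = x := hf.injective ((hk x).trans (hfh x hx))
      conv_lhs => rw [← h1]
      exact hinv x
  let e : X ≃ᵤ X := ⟨⟨k, k', hinv, hinv'⟩, hku, hku'⟩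
  have he : h = f ∘ e := funext fun x => (hk x).symm
  refine ⟨he ▸ hf.comp e.isUniformEmbedding, ?_⟩
  rw [he, e.surjective.range_comp]

/-! ### Gluing deformations along an exhaustion -/

/-- One step of the construction of a global deformation: a deformation that is finished where
`d ≤ N` is extended, by means of a deformation `Ψ` of a sublevel set of `d`, to one that is finished
where `d ≤ N + 1`, without a change where `d ≤ N - 1`. -/
lemma exists_extend_deformation {Y : Type*} [TopologicalSpace Y] {A : Set Y} {d : Y → ℝ}
    (hd : Continuous d) {Rel : Y → Y → Prop} (htrans : ∀ x y z, Rel x y → Rel y z → Rel x z)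
    {R R' N : ℝ} {Ψ : {y : Y // d y < R} × unitInterval → Y}
    (hΨ : Continuous Ψ) (hΨ0 : ∀ y, Ψ (y, 0) = y) (hΨ1 : ∀ y, Ψ (y, 1) ∈ A)
    (hΨA : ∀ y : {y : Y // d y < R}, (y : Y) ∈ A → ∀ t, Ψ (y, t) = y)
    (hΨrel : ∀ (y : {y : Y // d y < R}) t, Rel y (Ψ (y, t))) (hΨR : ∀ y t, d (Ψ (y, t)) < R')
    {G : Y × unitInterval → Y} (hG : Continuous G) (hG0 : ∀ y, G (y, 0) = y)
    (hG1 : ∀ y, d y ≤ N → G (y, 1) ∈ A) (hGA : ∀ y ∈ A, ∀ t, G (y, t) = y)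
    (hGrel : ∀ y t, Rel y (G (y, t))) (hGb : ∀ α, ∃ β, ∀ y t, d y < α → d (G (y, t)) < β)
    (hGR : ∀ y t, d y < N + 3 → d (G (y, t)) < R) :
    ∃ G' : Y × unitInterval → Y, Continuous G' ∧ (∀ y, G' (y, 0) = y) ∧
      (∀ y, d y ≤ N + 1 → G' (y, 1) ∈ A) ∧ (∀ y ∈ A, ∀ t, G' (y, t) = y) ∧
      (∀ y t, Rel y (G' (y, t))) ∧ (∀ α, ∃ β, ∀ y t, d y < α → d (G' (y, t)) < β) ∧
      ∀ y t, d y ≤ N - 1 → G' (y, t) = G (y, t) := by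
  classical
  -- the time for which `Ψ` is run: zero where `d ≤ N - 1` or `N + 2 ≤ d`, and complete at the end
  -- where `N ≤ d ≤ N + 1`
  let v : Y × unitInterval → unitInterval := fun p =>
    p.2 * projIcc (0 : ℝ) 1 zero_le_one (d p.1 - (N - 1)) *
      projIcc (0 : ℝ) 1 zero_le_one (N + 2 - d p.1)
  have hv : Continuous v := by
    refine (continuous_snd.mul (continuous_projIcc.comp ?_)).mul (continuous_projIcc.comp ?_)
    · exact (hd.comp continuous_fst).sub continuous_const
    · exact continuous_const.sub (hd.comp continuous_fst)
  have hv0 : ∀ y, v (y, 0) = 0 := fun y => by simp [v]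
  have hvlow : ∀ y t, d y ≤ N - 1 → v (y, t) = 0 := fun y t h => by
    have : projIcc (0 : ℝ) 1 zero_le_one (d y - (N - 1)) = 0 := projIcc_of_le_left _ (by linarith)
    simp [v, this]
  have hvhigh : ∀ y t, N + 2 ≤ d y → v (y, t) = 0 := fun y t h => by
    have : projIcc (0 : ℝ) 1 zero_le_one (N + 2 - d y) = 0 := projIcc_of_le_left _ (by linarith)
    simp [v, this]
  have hv1 : ∀ y, N ≤ d y → d y ≤ N + 1 → v (y, 1) = 1 := fun y h h' => by
    have h1 : projIcc (0 : ℝ) 1 zero_le_one (d y - (N - 1)) = 1 :=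
      projIcc_of_right_le _ (by linarith)
    have h2 : projIcc (0 : ℝ) 1 zero_le_one (N + 2 - d y) = 1 := projIcc_of_right_le _ (by linarith)
    simp [v, h1, h2]
  let G' : Y × unitInterval → Y := fun p =>
    if h : d (G p) < R then Ψ (⟨G p, h⟩, v p) else G p
  have hin : ∀ p, ∀ h : d (G p) < R, G' p = Ψ (⟨G p, h⟩, v p) := fun p h => dif_pos h
  have hout : ∀ p, v p = 0 → G' p = G p := by
    intro p hp
    by_cases h : d (G p) < R
    · rw [hin p h, hp, hΨ0]
    · exact dif_neg h
  refine ⟨G', ?_, fun y => ?_, fun y hy => ?_, fun y hy t => ?_, fun y t => ?_, fun α => ?_,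
    fun y t hy => hout _ (hvlow y t hy)⟩
  · rw [continuous_iff_continuousAt]
    rintro ⟨y, t⟩
    rcases lt_or_ge (d y) (N + 3) with h | h
    · have hopen : IsOpen {p : Y × unitInterval | d (G p) < R} :=
        isOpen_lt (hd.comp hG) continuous_const
      have hmem : (y, t) ∈ {p : Y × unitInterval | d (G p) < R} := hGR y t h
      have hcont : ContinuousOn G' {p : Y × unitInterval | d (G p) < R} := by
        rw [continuousOn_iff_continuous_domRestrict]
        have h1 : Continuous fun p : {p : Y × unitInterval | d (G p) < R} =>
            Ψ (⟨G p.1, p.2⟩, v p.1) :=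
          hΨ.comp (((hG.comp continuous_subtype_val).subtype_mk _).prodMk
            (hv.comp continuous_subtype_val))
        exact h1.congr fun p => (hin p.1 p.2).symm
      exact hcont.continuousAt (hopen.mem_nhds hmem)
    · have hopen : IsOpen {p : Y × unitInterval | N + 2 < d p.1} :=
        isOpen_lt continuous_const (hd.comp continuous_fst)
      refine hG.continuousAt.congr ?_
      filter_upwards [hopen.mem_nhds (show N + 2 < d y by linarith)] with p hp
      exact (hout p (hvhigh p.1 p.2 (le_of_lt hp))).symm
  · rw [hout _ (hv0 y), hG0]
  · have hR : d (G (y, 1)) < R := hGR y 1 (by linarith)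
    rw [hin _ hR]
    rcases le_total (d y) N with h | h
    · rw [hΨA _ (hG1 y h)]
      exact hG1 y h
    · rw [hv1 y h hy]
      exact hΨ1 _
  · have h1 := hGA y hy t
    by_cases h : d (G (y, t)) < R
    · rw [hin _ h, hΨA ⟨_, h⟩ (by simpa only [h1] using hy)]
      exact h1
    · exact (dif_neg h).trans h1
  · by_cases h : d (G (y, t)) < R
    · rw [hin _ h]
      exact htrans _ _ _ (hGrel y t) (hΨrel ⟨_, h⟩ _)
    · have : G' (y, t) = G (y, t) := dif_neg h
      rw [this]
      exact hGrel y t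
  · obtain ⟨β, hβ⟩ := hGb α
    refine ⟨max β R', fun y t hy => ?_⟩
    by_cases h : d (G (y, t)) < R
    · rw [hin _ h]
      exact (hΨR _ _).trans_le (le_max_right _ _)
    · have : G' (y, t) = G (y, t) := dif_neg h
      rw [this]
      exact (hβ y t hy).trans_le (le_max_left _ _)

/-- If every sublevel set of `d : Y → ℝ` can be deformed into `A` within `Y`, with `A` fixed
throughout, then `A` is a strong deformation retract of `Y`; a preorder that relates every point to
its trace is inherited. -/
theorem exists_strongDeformationRetraction_of_sublevel {Y : Type*} [TopologicalSpace Y] (A : Set Y)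
    {d : Y → ℝ} (hd : Continuous d) (hd0 : ∀ y, 0 ≤ d y) {Rel : Y → Y → Prop}
    (hrefl : ∀ y, Rel y y) (htrans : ∀ x y z, Rel x y → Rel y z → Rel x z)
    (hloc : ∀ R : ℝ, 0 < R → ∃ (R' : ℝ) (Ψ : {y : Y // d y < R} × unitInterval → Y),
      Continuous Ψ ∧ (∀ y, Ψ (y, 0) = y) ∧ (∀ y, Ψ (y, 1) ∈ A) ∧
      (∀ y : {y : Y // d y < R}, (y : Y) ∈ A → ∀ t, Ψ (y, t) = y) ∧
      (∀ (y : {y : Y // d y < R}) t, Rel y (Ψ (y, t))) ∧ ∀ y t, d (Ψ (y, t)) < R') :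
    ∃ Φ : Y × unitInterval → Y, IsStrongDeformationRetraction A Φ ∧ (∀ y t, Rel y (Φ (y, t))) ∧
      ∀ α, ∃ β, ∀ y t, d y < α → d (Φ (y, t)) < β := by
  -- `Good N G`: the deformation `G` is finished where `d ≤ N - 1`
  let Good : ℕ → (Y × unitInterval → Y) → Prop := fun N G =>
    Continuous G ∧ (∀ y, G (y, 0) = y) ∧ (∀ y, d y ≤ (N : ℝ) - 1 → G (y, 1) ∈ A) ∧
      (∀ y ∈ A, ∀ t, G (y, t) = y) ∧ (∀ y t, Rel y (G (y, t))) ∧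
      ∀ α, ∃ β, ∀ y t, d y < α → d (G (y, t)) < β
  have h0 : Good 0 fun p => p.1 := by
    refine ⟨continuous_fst, fun y => rfl, fun y hy => ?_, fun _ _ _ => rfl, fun y _ => hrefl y,
      fun α => ⟨α, fun y t h => h⟩⟩
    have := hd0 y
    norm_num at hy
    linarith
  have hstep : ∀ N G, Good N G →
      ∃ G', Good (N + 1) G' ∧ ∀ y t, d y ≤ (N : ℝ) - 2 → G' (y, t) = G (y, t) := by
    rintro N G ⟨hG, hG0, hG1, hGA, hGrel, hGb⟩
    obtain ⟨β, hβ⟩ := hGb ((N : ℝ) - 1 + 3)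
    obtain ⟨R', Ψ, hΨ, hΨ0, hΨ1, hΨA, hΨrel, hΨR⟩ := hloc (max β 1) (by positivity)
    obtain ⟨G', h1, h2, h3, h4, h5, h6, h7⟩ := exists_extend_deformation hd htrans hΨ hΨ0 hΨ1 hΨA
      hΨrel hΨR hG hG0 hG1 hGA hGrel hGb
      (fun y t hy => (hβ y t hy).trans_le (le_max_left _ _))
    refine ⟨G', ⟨h1, h2, fun y hy => h3 y ?_, h4, h5, h6⟩, fun y t hy => h7 y t (by linarith)⟩
    push_cast at hy
    linarith
  choose! next hnext hagree using hstep
  obtain ⟨G, hGood, hsucc⟩ : ∃ G : ℕ → Y × unitInterval → Y, (∀ N, Good N (G N)) ∧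
      ∀ (N : ℕ) y t, d y ≤ (N : ℝ) - 2 → G (N + 1) (y, t) = G N (y, t) := by
    let G : ℕ → Y × unitInterval → Y := fun N => Nat.rec (fun p => p.1) (fun N G => next N G) N
    have hGood : ∀ N, Good N (G N) := by
      intro N
      induction N with
      | zero => exact h0
      | succ N ih => exact hnext N (G N) ih
    exact ⟨G, hGood, fun N y t h => hagree N (G N) (hGood N) y t h⟩
  have hstab : ∀ N K : ℕ, N ≤ K → ∀ y t, d y ≤ (N : ℝ) - 2 → G K (y, t) = G N (y, t) := by
    intro N K hNK y t hy
    induction K, hNK using Nat.le_induction with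
    | base => rfl
    | succ K hK ih =>
      have : (N : ℝ) ≤ K := by exact_mod_cast hK
      rw [hsucc K y t (by linarith), ih]
  let Φ : Y × unitInterval → Y := fun p => G (⌈d p.1⌉₊ + 2) p
  have hΦ : ∀ N : ℕ, ∀ y t, d y ≤ (N : ℝ) - 2 → Φ (y, t) = G N (y, t) := by
    intro N y t hy
    refine (hstab (⌈d y⌉₊ + 2) N ?_ y t ?_).symm
    · have h1 : d y ≤ ((N - 2 : ℕ) : ℝ) := hy.trans (by
        rw [sub_le_iff_le_add]
        exact_mod_cast (by omega : N ≤ N - 2 + 2))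
      have h2 : ⌈d y⌉₊ ≤ N - 2 := Nat.ceil_le.2 h1
      have h3 : (2 : ℝ) ≤ N := by linarith [hd0 y]
      have h4 : 2 ≤ N := by exact_mod_cast h3
      omega
    · push_cast
      linarith [Nat.le_ceil (d y)]
  have hΦ' : ∀ y t, Φ (y, t) = G (⌈d y⌉₊ + 2) (y, t) := fun _ _ => rfl
  refine ⟨Φ, ⟨?_, fun y => ?_, fun y => ?_, fun y hy t => ?_⟩, fun y t => ?_, fun α => ?_⟩
  · rw [continuous_iff_continuousAt]
    rintro ⟨y, t⟩
    refine ((hGood (⌈d y⌉₊ + 3)).1.continuousAt).congr ?_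
    have hopen : IsOpen {p : Y × unitInterval | d p.1 < d y + 1} :=
      isOpen_lt (hd.comp continuous_fst) continuous_const
    filter_upwards [hopen.mem_nhds (show d y < d y + 1 by linarith)] with p hp
    have hp' : d p.1 < d y + 1 := hp
    refine (hΦ _ p.1 p.2 ?_).symm
    push_cast
    linarith [Nat.le_ceil (d y)]
  · rw [hΦ']; exact (hGood _).2.1 y
  · rw [hΦ']
    refine (hGood _).2.2.1 y ?_
    push_cast
    linarith [Nat.le_ceil (d y)]
  · rw [hΦ']; exact (hGood _).2.2.2.1 y hy t
  · rw [hΦ']; exact (hGood _).2.2.2.2.1 y t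
  · obtain ⟨β, hβ⟩ := (hGood (⌈α⌉₊ + 2)).2.2.2.2.2 α
    refine ⟨β, fun y t hy => ?_⟩
    rw [hΦ (⌈α⌉₊ + 2) y t (by push_cast; linarith [Nat.le_ceil α])]
    exact hβ y t hy

/-! ### Tails of product ends -/

/-- The second coordinate of a point of the product end `L ≈ S × [1, ∞)`. -/
def height {M S : Type*} [MetricSpace M] [TopologicalSpace S] {L : Set M}
    (θ : S × Ici (1 : ℝ) ≃ₜ L) (x : L) : ℝ :=
  (θ.symm x).2

section Tail

variable {M S : Type*} [MetricSpace M] [TopologicalSpace S] {L : Set M}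
  {θ : S × Ici (1 : ℝ) ≃ₜ L} {n : ℕ} {r s a : ℝ}

lemma continuous_height : Continuous (height θ) :=
  continuous_subtype_val.comp (continuous_snd.comp θ.symm.continuous)

lemma coe_mem_tail_iff {x : L} : (x : M) ∈ tail θ r ↔ r ≤ height θ x := by
  constructor
  · rintro ⟨p, hp, hpx⟩
    have : θ p = x := Subtype.ext hpx
    rwa [height, ← this, θ.symm_apply_apply]
  · intro h
    exact ⟨θ.symm x, h, by rw [θ.apply_symm_apply]⟩

lemma tail_subset : tail θ r ⊆ L := by
  rintro _ ⟨p, -, rfl⟩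
  exact (θ p).2

lemma tail_anti (h : r ≤ s) : tail θ s ⊆ tail θ r := by
  rintro _ ⟨p, hp, rfl⟩
  exact ⟨p, h.trans hp, rfl⟩

lemma isCompact_height_le [CompactSpace S] (θ : S × Ici (1 : ℝ) ≃ₜ L) (a : ℝ) :
    IsCompact {x : L | height θ x ≤ a} := by
  have h1 : IsCompact (Subtype.val ⁻¹' Icc 1 a : Set (Ici (1 : ℝ))) :=
    isClosed_Ici.isClosedEmbedding_subtypeVal.isCompact_preimage isCompact_Icc
  have h2 := (isCompact_univ (X := S)).prod h1
  convert h2.image θ.continuous using 1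
  ext x
  constructor
  · intro hx
    exact ⟨θ.symm x, ⟨trivial, (θ.symm x).2.2, hx⟩, θ.apply_symm_apply x⟩
  · rintro ⟨p, hp, rfl⟩
    simpa [height] using hp.2.2

lemma isClosed_preimage_tail : IsClosed (Subtype.val ⁻¹' tail θ a : Set L) := by
  have : (Subtype.val ⁻¹' tail θ a : Set L) = {x | a ≤ height θ x} := by
    ext x; exact coe_mem_tail_iff
  rw [this]
  exact isClosed_le continuous_const continuous_height

lemma isCofinal_preimage_tail [CompactSpace S] (θ : S × Ici (1 : ℝ) ≃ₜ L) (a : ℝ) :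
    IsCofinal (Subtype.val ⁻¹' tail θ a : Set L) := by
  refine ⟨isClosed_preimage_tail, (isCompact_height_le θ a).of_isClosed_subset isClosed_closure ?_⟩
  refine closure_minimal (fun x hx => ?_) (isClosed_le continuous_height continuous_const)
  have : ¬ a ≤ height θ x := fun h => hx (coe_mem_tail_iff.2 h)
  exact (not_le.1 this).le

lemma exists_tail_subset_of_isCofinal (θ : S × Ici (1 : ℝ) ≃ₜ L) {H : Set L} (hH : IsCofinal H) :
    ∃ b₀ : ℝ, ∀ b, b₀ < b → tail θ b ⊆ Subtype.val '' H := by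
  obtain ⟨b₀, hb₀⟩ := hH.2.bddAbove_image (f := height θ) continuous_height.continuousOn
  refine ⟨b₀, fun b hb x hx => ⟨⟨x, tail_subset hx⟩, ?_, rfl⟩⟩
  by_contra hxH
  have h1 := hb₀ ⟨_, subset_closure hxH, rfl⟩
  have h2 : b ≤ height θ ⟨x, tail_subset hx⟩ := coe_mem_tail_iff.1 hx
  linarith

lemma IsIsolatedProperProductEnd.exists_lt_dist (hL : IsIsolatedProperProductEnd n L θ) {R : ℝ}
    (hR : 0 < R) : ∃ a₀ : ℝ, ∀ a, a₀ < a → ∀ x ∈ tail θ a, ∀ y, dist y x < R → y ∈ L := by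
  obtain ⟨G, hG, hGd⟩ := hL.isolated R hR
  obtain ⟨a₀, ha₀⟩ := exists_tail_subset_of_isCofinal θ hG
  refine ⟨a₀, fun a ha x hx y hy => ?_⟩
  by_contra hyL
  have h1 : setDist Lᶜ (Subtype.val '' G) ≤ edist y x :=
    (iInf₂_le y hyL).trans (iInf₂_le x (ha₀ a ha hx))
  have h2 := hGd.trans_le h1
  rw [edist_dist, ENNReal.ofReal_lt_ofReal_iff_of_nonneg hR.le] at h2
  linarith

lemma image_mem_nhds_of_mem_interior {x : L} (hx : (x : M) ∈ interior L) {U : Set L}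
    (hU : U ∈ 𝓝 x) : Subtype.val '' U ∈ 𝓝 (x : M) := by
  have h1 : Subtype.val '' U ∈ 𝓝[L] (x : M) := mem_nhds_subtype_iff_nhdsWithin.1 hU
  rwa [nhdsWithin_eq_nhds.2 (mem_interior_iff_mem_nhds.1 hx)] at h1

lemma tail_subset_interior_tail (hr : tail θ r ⊆ interior L) (hra : r < a) :
    tail θ a ⊆ interior (tail θ r) := by
  intro x hx
  have hxL := tail_subset hx
  have hU : {z : L | r < height θ z} ∈ 𝓝 (⟨x, hxL⟩ : L) :=
    (isOpen_lt continuous_const continuous_height).mem_nhds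
      (hra.trans_le (coe_mem_tail_iff.1 hx))
  have := image_mem_nhds_of_mem_interior (x := ⟨x, hxL⟩) (hr (tail_anti hra.le hx)) hU
  rw [mem_interior_iff_mem_nhds]
  refine Filter.mem_of_superset this ?_
  rintro _ ⟨z, hz, rfl⟩
  exact coe_mem_tail_iff.2 (le_of_lt hz)

end Tail

/-! ### Locality of the manifold boundary -/

lemma mem_manifoldBoundary_iff_of_isOpenEmbedding {n : ℕ} {X Y : Type*} [TopologicalSpace X]
    [TopologicalSpace Y] {i : X → Y} (hi : IsOpenEmbedding i) (x : X) :
    i x ∈ manifoldBoundary n Y ↔ x ∈ manifoldBoundary n X := by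
  have : Nonempty X := ⟨x⟩
  refine not_congr ⟨?_, ?_⟩
  · rintro ⟨e, he⟩
    exact ⟨(hi.toOpenPartialHomeomorph i).trans e, by simpa using he⟩
  · rintro ⟨e, he⟩
    refine ⟨(hi.toOpenPartialHomeomorph i).symm.trans e, ?_⟩
    rw [OpenPartialHomeomorph.trans_source]
    refine ⟨by simp, ?_⟩
    have : (hi.toOpenPartialHomeomorph i).symm (i x) = x :=
      (hi.toOpenPartialHomeomorph i).left_inv (x := x) (by simp)
    rw [mem_preimage, this]
    exact he

lemma coe_mem_manifoldBoundary_iff {n : ℕ} {M : Type*} [TopologicalSpace M] {L : Set M} {x : L}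
    (hx : (x : M) ∈ interior L) :
    (x : M) ∈ manifoldBoundary n M ↔ x ∈ manifoldBoundary n L := by
  let j : interior L → L := inclusion interior_subset
  have hj : IsOpenEmbedding j := by
    refine ⟨.inclusion interior_subset, ?_⟩
    rw [range_inclusion]
    exact isOpen_interior.preimage continuous_subtype_val
  have h1 := mem_manifoldBoundary_iff_of_isOpenEmbedding (n := n) hj ⟨x, hx⟩
  have h2 := mem_manifoldBoundary_iff_of_isOpenEmbedding (n := n)
    isOpen_interior.isOpenEmbedding_subtypeVal (⟨x, hx⟩ : interior L)
  exact h2.trans h1.symm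

/-! ### Embedding spaces -/

section Emb

variable {M : Type*} [MetricSpace M] {n : ℕ} {F : Set M}

/-- The distance of a bounded embedding to the inclusion, as a real number. -/
noncomputable def deviation (f : boundedEmb n F ∅) : ℝ :=
  (edist (f : F →ᵤ M) (incl F)).toReal

lemma continuous_deviation : Continuous (deviation : boundedEmb n F ∅ → ℝ) := by
  rw [continuous_iff_continuousAt]
  intro f
  have h1 : Continuous fun f : boundedEmb n F ∅ => edist (f : F →ᵤ M) (incl F) :=
    continuous_subtype_val.edist continuous_const
  exact (ENNReal.tendsto_toReal f.2.2.ne).comp (h1.tendsto f)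

lemma deviation_nonneg (f : boundedEmb n F ∅) : 0 ≤ deviation f := ENNReal.toReal_nonneg

lemma deviation_lt_iff {f : boundedEmb n F ∅} {α : ℝ} :
    deviation f < α ↔ (f : F →ᵤ M) ∈ ballEmb n F ∅ α := by
  rw [deviation, ← ENNReal.lt_ofReal_iff_toReal_lt f.2.2.ne]
  exact ⟨fun h => ⟨f.2.1, h⟩, fun h => h.2⟩

lemma dist_le_deviation (f : boundedEmb n F ∅) (x : F) :
    dist (UniformFun.toFun (f : F →ᵤ M) x) x ≤ deviation f := by
  have h : edist (UniformFun.toFun (f : F →ᵤ M) x) x ≤ edist (f : F →ᵤ M) (incl F) :=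
    UniformFun.edist_eval_le
  rw [dist_edist]
  exact ENNReal.toReal_mono f.2.2.ne h

lemma deviation_le {f : boundedEmb n F ∅} {C : ℝ} (hC : 0 ≤ C)
    (h : ∀ x : F, dist (UniformFun.toFun (f : F →ᵤ M) x) x ≤ C) : deviation f ≤ C := by
  refine ENNReal.toReal_le_of_le_ofReal hC (UniformFun.edist_le.2 fun x => ?_)
  rw [edist_dist]
  exact ENNReal.ofReal_le_ofReal (h x)

/-- `g` arises from the embedding `f` by a modification within the set `A` that preserves the image
of `f`, if that contains `A`, and does not destroy the property of being the identity on the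
boundary. -/
structure IsModification (n : ℕ) (A : Set M) (f g : F →ᵤ M) : Prop where
  eq_of_notMem : ∀ x : F, UniformFun.toFun f x ∉ interior A → (x : M) ∉ interior A →
    UniformFun.toFun g x = UniformFun.toFun f x
  range_eq : A ⊆ range (UniformFun.toFun f) →
    range (UniformFun.toFun g) = range (UniformFun.toFun f)
  boundary : (∀ x : F, (x : M) ∈ manifoldBoundary n M → UniformFun.toFun f x = x) →
    ∀ x : F, (x : M) ∈ manifoldBoundary n M → UniformFun.toFun g x = x

lemma IsModification.refl (A : Set M) (f : F →ᵤ M) : IsModification n A f f :=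
  ⟨fun _ _ _ => rfl, fun _ => rfl, fun h => h⟩

lemma IsModification.trans {A : Set M} {f g h : F →ᵤ M} (h₁ : IsModification n A f g)
    (h₂ : IsModification n A g h) : IsModification n A f h := by
  refine ⟨fun x hfx hx => ?_, fun hA => ?_, fun hf => h₂.boundary (h₁.boundary hf)⟩
  · have h3 := h₁.eq_of_notMem x hfx hx
    exact (h₂.eq_of_notMem x (h3.symm ▸ hfx) hx).trans h3
  · have h3 := h₁.range_eq hA
    exact (h₂.range_eq (h3.symm ▸ hA)).trans h3

lemma IsModification.mono {A B : Set M} (hAB : A ⊆ B) {f g : F →ᵤ M}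
    (h : IsModification n A f g) : IsModification n B f g :=
  ⟨fun x hfx hx => h.eq_of_notMem x (fun h' => hfx (interior_mono hAB h'))
    fun h' => hx (interior_mono hAB h'), fun hB => h.range_eq (hAB.trans hB), h.boundary⟩

end Emb

lemma continuous_of_edist_le {W A B : Type*} [TopologicalSpace W] [PseudoEMetricSpace A]
    [PseudoEMetricSpace B] {f : W → A} {g : W → B} (hg : Continuous g)
    (h : ∀ x y, edist (f x) (f y) ≤ edist (g x) (g y)) : Continuous f := by
  rw [continuous_iff_continuousAt]
  intro x
  refine tendsto_iff_edist_tendsto_0.2 ?_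
  have h1 := tendsto_iff_edist_tendsto_0.1 (hg.tendsto x)
  exact tendsto_of_tendsto_of_tendsto_of_le_of_le tendsto_const_nhds h1
    (fun _ => zero_le) fun y => h y x

/-! ### Deformation by means of property (ED) -/

/-- An admissible deformation of embeddings of a closed subset `P` of a manifold that is fixed on
the frontier of `P` preserves images. -/
lemma range_eq_of_eq_on_frontier {L : Type*} [MetricSpace L] [ProperSpace L] {k : ℕ}
    (hL : IsManifoldWithBoundary (k + 1) L) {P : Set L} (hP : IsClosed P)
    {h : unitInterval → P →ᵤ L} (hc : Continuous h) (hemb : ∀ t, h t ∈ properEmb (k + 1) P ∅)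
    (hfr : ∀ t t', ∀ x : P, (x : L) ∈ frontier P →
      UniformFun.toFun (h t) x = UniformFun.toFun (h t') x) (t t' : unitInterval) :
    range (UniformFun.toFun (h t)) = range (UniformFun.toFun (h t')) := by
  classical
  have : CompleteSpace P := hP.completeSpace_coe
  have key : ∀ t t', range (UniformFun.toFun (h t)) ⊆ range (UniformFun.toFun (h t')) := by
    refine range_subset_of_isotopy (h := fun t => UniformFun.toFun (h t))
      (N := Subtype.val ⁻¹' interior P) (fun x => ?_) (fun t => (hemb t).1.injective)
      (fun x hx t t' => hfr t t' x ?_) (fun t => ?_) (fun t => ?_)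
    · exact (UniformFun.uniformContinuous_eval L x).continuous.comp hc
    · exact ⟨subset_closure x.2, hx⟩
    · exact (hemb t).1.isClosedEmbedding.isClosed_range
    · let G : L → L := fun x => if hx : x ∈ P then UniformFun.toFun (h t) ⟨x, hx⟩ else x
      have hG : ∀ x : P, G x = UniformFun.toFun (h t) x := fun x => dif_pos x.2
      have hGP : ContinuousOn G P := by
        rw [continuousOn_iff_continuous_domRestrict]
        exact (hemb t).1.uniformContinuous.continuous.congr fun x => (hG x).symm
      have hopen := isOpen_image_of_mem_manifoldBoundary_iff hL (isOpen_interior (s := P))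
        (hGP.mono interior_subset) (fun x hx y hy hxy => by
          have hx' := interior_subset hx
          have hy' := interior_subset hy
          rw [hG ⟨x, hx'⟩, hG ⟨y, hy'⟩] at hxy
          exact congrArg Subtype.val ((hemb t).1.injective hxy)) (fun x hx => by
          rw [hG ⟨x, interior_subset hx⟩]
          exact (hemb t).2.1 ⟨x, interior_subset hx⟩)
      convert hopen using 1
      ext y
      constructor
      · rintro ⟨x, hx, rfl⟩
        exact ⟨x, hx, hG x⟩
      · rintro ⟨x, hx, rfl⟩
        exact ⟨⟨x, interior_subset hx⟩, hx, (hG ⟨x, interior_subset hx⟩).symm⟩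
  exact Subset.antisymm (key t t') (key t' t)

/-- Property (ED) of an end `L` of `M` deforms all embeddings of deviation less than `R` to
embeddings that are the identity on some tail of `L`. The deformation provided by (ED) for a tail of
`L`, which is so far out that embeddings of deviation less than `R` keep it in `L`, is extended by
the embedding itself. -/
theorem exists_deformation_of_hasED {M S : Type*} [MetricSpace M] [TopologicalSpace S] {n : ℕ}
    {L : Set M} {θ : S × Ici (1 : ℝ) ≃ₜ L} (hL : IsIsolatedProperProductEnd n L θ)
    (hED : HasED n L) {F : Set M} (hF : IsClosed F) {r s : ℝ} (hrs : r < s)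
    (hrF : tail θ r ⊆ interior (F ∩ L)) {R : ℝ} (hR : 0 < R) :
    ∃ (b R' : ℝ) (D : {f : boundedEmb n F ∅ // deviation f < R} × unitInterval → boundedEmb n F ∅),
      s < b ∧ Continuous D ∧ (∀ f, D (f, 0) = f) ∧
      (∀ f, ∀ x : F, (x : M) ∈ tail θ b → UniformFun.toFun (D (f, 1) : F →ᵤ M) x = x) ∧
      (∀ f : {f : boundedEmb n F ∅ // deviation f < R},
        (∀ x : F, (x : M) ∈ tail θ s → UniformFun.toFun (f.1 : F →ᵤ M) x = x) →
          ∀ t, D (f, t) = f) ∧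
      (∀ (f : {f : boundedEmb n F ∅ // deviation f < R}) t,
        IsModification n (tail θ r) (f.1 : F →ᵤ M) (D (f, t) : F →ᵤ M)) ∧
      ∀ f t, deviation (D (f, t)) < R' := by
  classical
  obtain ⟨k, rfl, -⟩ := hL.productEnd.base
  have := hL.productEnd.compact
  have := hL.productEnd.proper
  obtain ⟨a₀, ha₀⟩ := hL.exists_lt_dist hR
  set a : ℝ := max a₀ s + 1 with ha
  have has : s < a := (le_max_right _ _).trans_lt (lt_add_one _)
  have hfar := ha₀ a ((le_max_left _ _).trans_lt (lt_add_one _))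
  have hra : tail θ a ⊆ tail θ r := tail_anti (hrs.trans has).le
  have haF : tail θ a ⊆ F := fun x hx => (interior_subset (hrF (hra hx))).1
  have haint : ∀ x ∈ tail θ a, x ∈ interior L := fun x hx =>
    interior_mono inter_subset_right (hrF (hra hx))
  set P : Set L := Subtype.val ⁻¹' tail θ a with hP
  have hPc : IsClosed P := isClosed_preimage_tail
  obtain ⟨β, hβ, H, hH, -, φ, hφ, hφfr⟩ := hED P (isCofinal_preimage_tail θ a) R hR
  obtain ⟨b₀, hb₀⟩ := exists_tail_subset_of_isCofinal θ hH
  set b : ℝ := max a b₀ + 1 with hb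
  have hab : a < b := (le_max_left _ _).trans_lt (lt_add_one _)
  have hbH := hb₀ b ((le_max_right _ _).trans_lt (lt_add_one _))
  -- restriction of embeddings to the tail
  let toF : P → F := fun x => ⟨x.1.1, haF x.2⟩
  have htoF : Isometry toF := fun x y => rfl
  have hmaps : ∀ f : {f : boundedEmb (k + 1) F ∅ // deviation f < R}, ∀ x : F, (x : M) ∈ tail θ a →
      UniformFun.toFun (f.1 : F →ᵤ M) x ∈ interior L := by
    intro f x hx
    have h1 := (dist_le_deviation f.1 x).trans_lt f.2
    rw [mem_interior_iff_mem_nhds, Metric.mem_nhds_iff]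
    refine ⟨R - dist (UniformFun.toFun (f.1 : F →ᵤ M) x) x, by linarith, fun y hy => ?_⟩
    refine hfar x hx y ?_
    rw [Metric.mem_ball] at hy
    linarith [dist_triangle y (UniformFun.toFun (f.1 : F →ᵤ M) x) x]
  let res₀ : {f : boundedEmb (k + 1) F ∅ // deviation f < R} → P →ᵤ L := fun f =>
    UniformFun.ofFun fun x =>
      ⟨UniformFun.toFun (f.1 : F →ᵤ M) (toF x), interior_subset (hmaps f _ x.2)⟩
  have hres₀ : ∀ f x, ((UniformFun.toFun (res₀ f) x : L) : M) =
      UniformFun.toFun (f.1 : F →ᵤ M) (toF x) := fun f x => rfl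
  have hmem : ∀ f, res₀ f ∈ ballEmb (k + 1) P ∅ R := by
    intro f
    refine ⟨⟨?_, fun x => ?_, fun x hx => absurd hx (notMem_empty _)⟩, ?_⟩
    · rw [← (show IsUniformEmbedding (Subtype.val : L → M) from
        ⟨isUniformInducing_val L, Subtype.val_injective⟩).of_comp_iff]
      exact f.1.2.1.1.comp htoF.isUniformEmbedding
    · rw [← coe_mem_manifoldBoundary_iff (hmaps f (toF x) x.2),
        ← coe_mem_manifoldBoundary_iff (haint _ x.2)]
      exact f.1.2.1.2.1 (toF x)
    · refine lt_of_le_of_lt ?_ ((deviation_lt_iff (f := f.1)).1 f.2).2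
      exact UniformFun.edist_le.2 fun x => UniformFun.edist_eval_le (x := toF x)
        (f := (f.1 : F →ᵤ M)) (g := incl F)
  let res : {f : boundedEmb (k + 1) F ∅ // deviation f < R} → ballEmb (k + 1) P ∅ R :=
    fun f => ⟨res₀ f, hmem f⟩
  have hresc : Continuous res := by
    refine Continuous.subtype_mk ?_ _
    refine continuous_of_edist_le
      (g := fun f : {f : boundedEmb (k + 1) F ∅ // deviation f < R} => (f.1 : F →ᵤ M))
      (continuous_subtype_val.comp continuous_subtype_val) fun f g => ?_
    exact UniformFun.edist_le.2 fun x => UniformFun.edist_eval_le (x := toF x)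
        (f := (f.1 : F →ᵤ M)) (g := (g.1 : F →ᵤ M))
  -- the deformed embedding on the tail, and the images
  let h : {f : boundedEmb (k + 1) F ∅ // deviation f < R} → unitInterval → P →ᵤ L :=
    fun f t => φ (res f, t)
  have hh0 : ∀ f, h f 0 = res₀ f := fun f => hφ.zero (res f)
  have hhemb : ∀ f t, h f t ∈ properEmb (k + 1) P ∅ := fun f t => (φ (res f, t)).2.1
  have hhfr : ∀ f t, ∀ x : P, (x : L) ∈ frontier P →
      UniformFun.toFun (h f t) x = UniformFun.toFun (res₀ f) x := fun f t x hx =>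
    hφfr (res f) t x hx
  have hhrange : ∀ f t, range (UniformFun.toFun (h f t)) = range (UniformFun.toFun (res₀ f)) := by
    intro f t
    rw [← hh0 f]
    refine range_eq_of_eq_on_frontier hL.productEnd.manifold hPc (h := h f) ?_ (hhemb f) ?_ t 0
    · exact continuous_subtype_val.comp
        (hφ.continuous.comp (continuous_const.prodMk continuous_id))
    · intro t t' x hx
      rw [hhfr f t x hx, hhfr f t' x hx]
  have hhint : ∀ f t x, ((UniformFun.toFun (h f t) x : L) : M) ∈ interior L := by
    intro f t x
    obtain ⟨y, hy⟩ := hhrange f t ▸ mem_range_self x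
    rw [← hy]
    exact hmaps f (toF y) y.2
  let d : {f : boundedEmb (k + 1) F ∅ // deviation f < R} → unitInterval → F → M := fun f t x =>
    if hx : (x : M) ∈ tail θ a then
      ((UniformFun.toFun (h f t) ⟨⟨x, tail_subset hx⟩, hx⟩ : L) : M)
    else UniformFun.toFun (f.1 : F →ᵤ M) x
  have hdin : ∀ f t (x : P), d f t (toF x) = ((UniformFun.toFun (h f t) x : L) : M) :=
    fun f t x => dif_pos x.2
  have hdin' : ∀ f t (x : F) (hx : (x : M) ∈ tail θ a),
      d f t x = ((UniformFun.toFun (h f t) ⟨⟨x, tail_subset hx⟩, hx⟩ : L) : M) :=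
    fun f t x hx => dif_pos hx
  have hdout : ∀ f t (x : F), (x : M) ∉ tail θ a → d f t x = UniformFun.toFun (f.1 : F →ᵤ M) x :=
    fun f t x hx => dif_neg hx
  have hLM : IsClosedEmbedding (Subtype.val : L → M) := hL.closed.isClosedEmbedding_subtypeVal
  have hglue : ∀ f t, IsUniformEmbedding (d f t) ∧
      range (d f t) = range (UniformFun.toFun (f.1 : F →ᵤ M)) := by
    intro f t
    refine isUniformEmbedding_glue (P := {x : F | (x : M) ∈ tail θ a})
      (K := Subtype.val ⁻¹' (Subtype.val '' {x : L | height θ x ≤ a}))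
      ?_ f.1.2.1.1 ?_ ?_ ?_ ?_ hR ?_
    · have h1 : IsClosed (Subtype.val '' P : Set M) := hLM.isClosedMap _ hPc
      have h2 : (Subtype.val '' P : Set M) = tail θ a :=
        Subset.antisymm (image_preimage_subset _ _) fun x hx => ⟨⟨x, tail_subset hx⟩, hx, rfl⟩
      rw [h2] at h1
      exact h1.preimage continuous_subtype_val
    · let j : {x : F | (x : M) ∈ tail θ a} → P := fun x => ⟨⟨x.1.1, tail_subset x.2⟩, x.2⟩
      have hj : Isometry j := fun x y => rfl
      have h1 : domRestrict {x : F | (x : M) ∈ tail θ a} (d f t) =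
          Subtype.val ∘ UniformFun.toFun (h f t) ∘ j := funext fun x => hdin' f t x.1 x.2
      rw [h1]
      exact (show IsUniformEmbedding (Subtype.val : L → M) from
        ⟨isUniformInducing_val L, Subtype.val_injective⟩).comp
          ((hhemb f t).1.comp hj.isUniformEmbedding)
    · intro x hx
      by_cases hxa : (x : M) ∈ tail θ a
      · have hfrx : (⟨(x : M), tail_subset hxa⟩ : L) ∈ frontier P := by
          refine ⟨subset_closure hxa, fun hxi => ?_⟩
          have h1 := image_mem_nhds_of_mem_interior (x := (⟨(x : M), tail_subset hxa⟩ : L))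
            (haint x hxa) (mem_interior_iff_mem_nhds.1 hxi)
          have h2 : {y : F | (y : M) ∈ tail θ a} ∈ 𝓝 x := by
            refine Filter.mem_of_superset
              (continuous_subtype_val.continuousAt.preimage_mem_nhds h1) ?_
            rintro y ⟨z, hz, hzy⟩
            show (y : M) ∈ tail θ a
            rw [← hzy]
            exact hz
          obtain ⟨y, hy1, hy2⟩ := mem_closure_iff_nhds.1 hx _ h2
          exact hy2 hy1
        rw [hdin' f t x hxa]
        exact congrArg Subtype.val (hhfr f t _ hfrx)
      · exact hdout f t x hxa
    · have h1 : ∀ g : F → M, g '' {x : F | (x : M) ∈ tail θ a} = range (g ∘ toF) := by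
        intro g
        ext y
        constructor
        · rintro ⟨x, hx, rfl⟩
          exact ⟨⟨⟨x, tail_subset hx⟩, hx⟩, rfl⟩
        · rintro ⟨x, rfl⟩
          exact ⟨toF x, x.2, rfl⟩
      rw [h1, h1]
      have h2 : d f t ∘ toF = Subtype.val ∘ UniformFun.toFun (h f t) := funext (hdin f t)
      have h3 : UniformFun.toFun (f.1 : F →ᵤ M) ∘ toF = Subtype.val ∘ UniformFun.toFun (res₀ f) :=
        rfl
      rw [h2, h3, range_comp, range_comp, hhrange]
    · exact hF.isClosedEmbedding_subtypeVal.isCompact_preimage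
        ((isCompact_height_le θ a).image continuous_subtype_val)
    · intro x hx y hy hxy
      right
      have hyL : (y : M) ∈ L := hfar x hx y (by rwa [dist_comm])
      refine ⟨⟨y, hyL⟩, ?_, rfl⟩
      have h1 : ¬ a ≤ height θ ⟨(y : M), hyL⟩ := fun h =>
        hy ((coe_mem_tail_iff (x := (⟨(y : M), hyL⟩ : L))).2 h)
      exact (not_le.1 h1).le
  have hdprop : ∀ f t, UniformFun.ofFun (d f t) ∈ properEmb (k + 1) F ∅ := by
    intro f t
    refine ⟨(hglue f t).1, fun x => ?_, fun x hx => absurd hx (notMem_empty _)⟩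
    rw [UniformFun.toFun_ofFun]
    by_cases hxa : (x : M) ∈ tail θ a
    · rw [hdin' f t x hxa, coe_mem_manifoldBoundary_iff (hhint f t _)]
      have h1 := coe_mem_manifoldBoundary_iff (n := k + 1)
        (x := (⟨(x : M), tail_subset hxa⟩ : L)) (haint x hxa)
      exact ((hhemb f t).2.1 _).trans h1.symm
    · rw [hdout f t x hxa]
      exact f.1.2.1.2.1 x
  have hdev : ∀ f t (x : F), dist (d f t x) x ≤ max R β := by
    intro f t x
    by_cases hxa : (x : M) ∈ tail θ a
    · refine le_trans ?_ (le_max_right _ _)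
      have h1 : edist (UniformFun.toFun (h f t) ⟨⟨x, tail_subset hxa⟩, hxa⟩) ⟨x, tail_subset hxa⟩ ≤
          edist (h f t) (incl P) := UniformFun.edist_eval_le
      have h2 := h1.trans_lt (φ (res f, t)).2.2
      rw [edist_dist, ENNReal.ofReal_lt_ofReal_iff hβ] at h2
      rw [hdin' f t x hxa]
      exact h2.le
    · rw [hdout f t x hxa]
      exact ((dist_le_deviation f.1 x).trans f.2.le).trans (le_max_left _ _)
  let D : {f : boundedEmb (k + 1) F ∅ // deviation f < R} × unitInterval →
      boundedEmb (k + 1) F ∅ := fun p => ⟨UniformFun.ofFun (d p.1 p.2), hdprop p.1 p.2, by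
    refine lt_of_le_of_lt (UniformFun.edist_le.2 fun x => ?_)
      (ENNReal.ofReal_lt_top (r := max R β))
    rw [edist_dist]
    exact ENNReal.ofReal_le_ofReal (hdev p.1 p.2 x)⟩
  have hD : ∀ f t, UniformFun.toFun (D (f, t) : F →ᵤ M) = d f t := fun f t => rfl
  have hext : ∀ (f : {f : boundedEmb (k + 1) F ∅ // deviation f < R}) t, h f t = res₀ f →
      D (f, t) = f := by
    intro f t hft
    refine Subtype.ext (UniformFun.toFun.injective (funext fun x => ?_))
    rw [hD]
    by_cases hxa : (x : M) ∈ tail θ a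
    · rw [hdin' f t x hxa, hft, hres₀]
    · exact hdout f t x hxa
  refine ⟨b, max R β + 1, D, has.trans hab, ?_, fun f => hext f 0 (hh0 f), fun f x hx => ?_,
    fun f hf t => ?_, fun f t => ⟨fun x _ hx => ?_, fun _ => ?_, fun hf x hx => ?_⟩, fun f t => ?_⟩
  · refine Continuous.subtype_mk ?_ _
    refine continuous_of_edist_le
      (g := fun p : {f : boundedEmb (k + 1) F ∅ // deviation f < R} × unitInterval =>
        (h p.1 p.2, (p.1.1 : F →ᵤ M))) ?_ fun p q => ?_
    · refine Continuous.prodMk ?_ ?_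
      · exact continuous_subtype_val.comp (hφ.continuous.comp
          ((hresc.comp continuous_fst).prodMk continuous_snd))
      · exact continuous_subtype_val.comp (continuous_subtype_val.comp continuous_fst)
    · refine UniformFun.edist_le.2 fun x => ?_
      rw [UniformFun.toFun_ofFun, UniformFun.toFun_ofFun, Prod.edist_eq]
      by_cases hxa : (x : M) ∈ tail θ a
      · rw [hdin' _ _ x hxa, hdin' _ _ x hxa]
        exact le_trans (UniformFun.edist_eval_le (f := h p.1 p.2) (g := h q.1 q.2))
          (le_max_left _ _)
      · rw [hdout _ _ x hxa, hdout _ _ x hxa]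
        exact le_trans UniformFun.edist_eval_le (le_max_right _ _)
  · have hxa : (x : M) ∈ tail θ a := tail_anti hab.le hx
    obtain ⟨y, hy, hyx⟩ := hbH hx
    rw [hD, hdin' f 1 x hxa]
    have hy' : (⟨x, tail_subset hxa⟩ : L) ∈ H := by
      have : (⟨x, tail_subset hxa⟩ : L) = y := Subtype.ext hyx.symm
      rwa [this]
    exact congrArg Subtype.val (hφ.one (res f) ⟨⟨x, tail_subset hxa⟩, hxa⟩ hy')
  · have h1 : res₀ f = incl P := UniformFun.toFun.injective (funext fun x =>
      Subtype.ext (hf (toF x) (tail_anti has.le x.2)))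
    refine hext f t ?_
    rw [h1]
    exact hφ.incl (res f) h1 t
  · rw [hD]
    refine hdout f t x fun hxa => hx ?_
    exact tail_subset_interior_tail (fun y hy => interior_mono inter_subset_right (hrF hy))
      (hrs.trans has) hxa
  · rw [hD]
    exact (hglue f t).2
  · rw [hD]
    by_cases hxa : (x : M) ∈ tail θ a
    · rw [hdin' f t x hxa]
      have h1 := hφ.boundary (res f) (fun y hy => Subtype.ext (hf (toF y) ?_)) t
        ⟨⟨x, tail_subset hxa⟩, hxa⟩ ?_
      · exact congrArg Subtype.val h1
      · exact (coe_mem_manifoldBoundary_iff (haint _ y.2)).2 hy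
      · exact (coe_mem_manifoldBoundary_iff (x := (⟨(x : M), tail_subset hxa⟩ : L))
          (haint _ hxa)).1 hx
    · rw [hdout f t x hxa]
      exact hf x hx
  · refine lt_of_le_of_lt (deviation_le (le_max_of_le_left hR.le) fun x => ?_) (lt_add_one _)
    exact hdev f t x

/-! ### Sliding along the half line -/

/-- The piecewise linear function on the line that is `0` off `[s - ε, b + 1]` and `1` at `b`. -/
noncomputable def tent (s b ε x : ℝ) : ℝ :=
  max 0 (min ((x - (s - ε)) / (b - s + ε)) (b + 1 - x))

/-- The piecewise linear self-map of the line that is the identity off `[s - ε, b + 1]` and moves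
`b` to `(1 - u) b + u s`. For `ε = 0` and `u = 1` it collapses `[s, b]` to a point. -/
noncomputable def slide (s b ε u x : ℝ) : ℝ := x - u * (b - s) * tent s b ε x

section Slide

variable {s b ε u x y : ℝ}

lemma tent_eq_zero_of_le (hsb : s < b) (hε : 0 ≤ ε) (hx : x ≤ s - ε) : tent s b ε x = 0 := by
  refine max_eq_left ((min_le_left _ _).trans ?_)
  exact div_nonpos_of_nonpos_of_nonneg (by linarith) (by linarith)

lemma tent_eq_zero_of_ge (hx : b + 1 ≤ x) : tent s b ε x = 0 :=
  max_eq_left ((min_le_right _ _).trans (by linarith))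

lemma tent_le_add (hsb : s < b) (hε : 0 ≤ ε) (hxy : x ≤ y) :
    tent s b ε y ≤ tent s b ε x + (y - x) / (b - s + ε) := by
  have hw : 0 < b - s + ε := by linarith
  have h0 : 0 ≤ (y - x) / (b - s + ε) := div_nonneg (by linarith) hw.le
  refine max_le (add_nonneg (le_max_left _ _) h0) ?_
  calc min ((y - (s - ε)) / (b - s + ε)) (b + 1 - y)
      ≤ min ((x - (s - ε)) / (b - s + ε) + (y - x) / (b - s + ε))
          (b + 1 - x + (y - x) / (b - s + ε)) := by
        refine min_le_min (le_of_eq ?_) (by linarith)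
        rw [← add_div]; congr 1; ring
    _ = min ((x - (s - ε)) / (b - s + ε)) (b + 1 - x) + (y - x) / (b - s + ε) :=
        min_add_add_right _ _ _
    _ ≤ tent s b ε x + (y - x) / (b - s + ε) := by
        gcongr; exact le_max_right _ _

lemma slide_of_le (hsb : s < b) (hε : 0 ≤ ε) (hx : x ≤ s - ε) : slide s b ε u x = x := by
  rw [slide, tent_eq_zero_of_le hsb hε hx, mul_zero, sub_zero]

lemma slide_of_ge (hx : b + 1 ≤ x) : slide s b ε u x = x := by
  rw [slide, tent_eq_zero_of_ge hx, mul_zero, sub_zero]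

lemma slide_zero : slide s b ε 0 x = x := by simp [slide]

lemma slide_one_apply (hsb : s < b) (hε : 0 ≤ ε) : slide s b ε 1 b = s := by
  have hw : 0 < b - s + ε := by linarith
  have h1 : (b - (s - ε)) / (b - s + ε) = 1 := by
    rw [div_eq_one_iff_eq hw.ne']; ring
  have : tent s b ε b = 1 := by simp [tent, h1]
  rw [slide, this]; ring

lemma le_slide_sub_slide (hsb : s < b) (hε : 0 ≤ ε) (hu : 0 ≤ u) (hu1 : u ≤ 1) (hxy : x ≤ y) :
    (y - x) * (ε / (b - s + ε)) ≤ slide s b ε u y - slide s b ε u x := by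
  have hw : 0 < b - s + ε := by linarith
  have h1 := tent_le_add hsb hε hxy
  have h2 : u * (b - s) * (tent s b ε y - tent s b ε x) ≤ (b - s) * ((y - x) / (b - s + ε)) := by
    have h3 : 0 ≤ (y - x) / (b - s + ε) := div_nonneg (by linarith) hw.le
    calc u * (b - s) * (tent s b ε y - tent s b ε x)
        ≤ u * (b - s) * ((y - x) / (b - s + ε)) :=
          mul_le_mul_of_nonneg_left (by linarith) (mul_nonneg hu (by linarith))
      _ ≤ 1 * (b - s) * ((y - x) / (b - s + ε)) := by
          gcongr
      _ = (b - s) * ((y - x) / (b - s + ε)) := by rw [one_mul]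
  have h4 : (y - x) * (ε / (b - s + ε)) = (y - x) - (b - s) * ((y - x) / (b - s + ε)) := by
    field_simp
    ring
  rw [h4, slide, slide]
  linarith

lemma monotone_slide (hsb : s < b) (hε : 0 ≤ ε) (hu : 0 ≤ u) (hu1 : u ≤ 1) :
    Monotone (slide s b ε u) := fun x y hxy => by
  have h1 := le_slide_sub_slide hsb hε hu hu1 hxy
  have h2 : 0 ≤ (y - x) * (ε / (b - s + ε)) :=
    mul_nonneg (by linarith) (div_nonneg hε (by linarith))
  linarith

lemma strictMono_slide (hsb : s < b) (hε : 0 < ε) (hu : 0 ≤ u) (hu1 : u ≤ 1) :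
    StrictMono (slide s b ε u) := fun x y hxy => by
  have h1 := le_slide_sub_slide hsb hε.le hu hu1 hxy.le
  have h2 : 0 < (y - x) * (ε / (b - s + ε)) :=
    mul_pos (by linarith) (div_pos hε (by linarith))
  linarith

lemma continuous_slide {W : Type*} [TopologicalSpace W] (hsb : s < b) {ε u x : W → ℝ}
    (hε : Continuous ε) (hε0 : ∀ w, 0 ≤ ε w) (hu : Continuous u) (hx : Continuous x) :
    Continuous fun w => slide s b (ε w) (u w) (x w) := by
  have h1 : Continuous fun w => (x w - (s - ε w)) / (b - s + ε w) :=
    Continuous.div (by fun_prop) (by fun_prop) fun w => by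
      have := hε0 w
      have : 0 < b - s + ε w := by linarith
      exact this.ne'
  unfold MetricEnd.slide tent
  fun_prop

end Slide

/-- A continuous monotone map of the line that is the identity off the interval `[p, q]`. -/
structure IsSlide (p q : ℝ) (τ : ℝ → ℝ) : Prop where
  continuous : Continuous τ
  monotone : Monotone τ
  eq_of_le : ∀ t, t ≤ p → τ t = t
  eq_of_ge : ∀ t, q ≤ t → τ t = t

lemma IsSlide.surjective {p q : ℝ} {τ : ℝ → ℝ} (h : IsSlide p q τ) : Function.Surjective τ := by
  refine h.continuous.surjective ?_ ?_
  · refine Filter.tendsto_id.congr' ?_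
    filter_upwards [Filter.eventually_ge_atTop q] with t ht using (h.eq_of_ge t ht).symm
  · refine Filter.tendsto_id.congr' ?_
    filter_upwards [Filter.eventually_le_atBot p] with t ht using (h.eq_of_le t ht).symm

lemma IsSlide.le_apply {p q : ℝ} {τ : ℝ → ℝ} (h : IsSlide p q τ) {a t : ℝ} (ha : a ≤ p)
    (hat : a ≤ t) : a ≤ τ t := by
  rw [← h.eq_of_le a ha]; exact h.monotone hat

lemma IsSlide.exists_inverse {p q : ℝ} {τ : ℝ → ℝ} (h : IsSlide p q τ) (hs : StrictMono τ) :
    ∃ τ', IsSlide p q τ' ∧ (∀ t, τ' (τ t) = t) ∧ ∀ t, τ (τ' t) = t := by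
  let e := hs.orderIsoOfSurjective τ h.surjective
  have he : ∀ t, e t = τ t := fun t => rfl
  have h1 : ∀ t, e.symm (τ t) = t := fun t => e.symm_apply_apply t
  refine ⟨e.symm, ⟨e.symm.continuous, e.symm.monotone, fun t ht => ?_, fun t ht => ?_⟩, h1,
    fun t => e.apply_symm_apply t⟩
  · conv_lhs => rw [← h.eq_of_le t ht]
    exact h1 t
  · conv_lhs => rw [← h.eq_of_ge t ht]
    exact h1 t

/-! ### Sliding along a product end -/

open Classical in
/-- The self-map of `M` that moves the points of the product end `L ≈ S × [1, ∞)` by the self-map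
`τ` of the second factor, truncated so as to take values in `[1, ∞)`, and fixes the points off `L`. -/
noncomputable def push {M S : Type*} [MetricSpace M] [TopologicalSpace S] {L : Set M}
    (θ : S × Ici (1 : ℝ) ≃ₜ L) (τ : ℝ → ℝ) (x : M) : M :=
  if hx : x ∈ L then
    θ ((θ.symm ⟨x, hx⟩).1, ⟨max 1 (τ (height θ ⟨x, hx⟩)), mem_Ici.2 (le_max_left _ _)⟩)
  else x

section Push

variable {M S : Type*} [MetricSpace M] [TopologicalSpace S] {L : Set M}
  {θ : S × Ici (1 : ℝ) ≃ₜ L} {τ τ' : ℝ → ℝ} {p q r : ℝ}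

lemma one_le_height (x : L) : 1 ≤ height θ x := mem_Ici.1 (θ.symm x).2.2

lemma push_coe (x : L) : push θ τ x =
    θ ((θ.symm x).1, ⟨max 1 (τ (height θ x)), mem_Ici.2 (le_max_left _ _)⟩) :=
  dif_pos x.2

lemma push_of_notMem {x : M} (hx : x ∉ L) : push θ τ x = x := dif_neg hx

lemma push_mem (x : L) : push θ τ x ∈ L := by
  rw [push_coe]; exact (θ _).2

lemma height_push (x : L) : height θ ⟨push θ τ x, push_mem x⟩ = max 1 (τ (height θ x)) := by
  have : (⟨push θ τ x, push_mem x⟩ : L) =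
      θ ((θ.symm x).1, ⟨max 1 (τ (height θ x)), mem_Ici.2 (le_max_left _ _)⟩) :=
    Subtype.ext (push_coe x)
  rw [this, height, θ.symm_apply_apply]

lemma push_eq_self (x : L) (h : τ (height θ x) = height θ x) : push θ τ x = x := by
  rw [push_coe]
  have : ((θ.symm x).1, (⟨max 1 (τ (height θ x)), mem_Ici.2 (le_max_left _ _)⟩ : Ici (1 : ℝ))) =
      θ.symm x := by
    refine Prod.ext rfl (Subtype.ext ?_)
    simp only [h, max_eq_right (one_le_height x)]
    rfl
  rw [this, θ.apply_symm_apply]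

lemma push_push (h1 : ∀ t, 1 ≤ t → 1 ≤ τ t) (hinv : ∀ t, τ' (τ t) = t) (x : M) :
    push θ τ' (push θ τ x) = x := by
  by_cases hx : x ∈ L
  · lift x to L using hx
    have h2 := push_coe (θ := θ) (τ := τ') (⟨push θ τ x, push_mem x⟩ : L)
    rw [show push θ τ' (push θ τ x) = _ from h2]
    have h3 : (⟨push θ τ x, push_mem x⟩ : L) =
      θ ((θ.symm x).1, ⟨max 1 (τ (height θ x)), mem_Ici.2 (le_max_left _ _)⟩) :=
      Subtype.ext (push_coe x)
    have h4 : ((θ.symm ⟨push θ τ x, push_mem x⟩).1,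
        (⟨max 1 (τ' (height θ ⟨push θ τ x, push_mem x⟩)),
        mem_Ici.2 (le_max_left _ _)⟩ : Ici (1 : ℝ))) = θ.symm x := by
      refine Prod.ext ?_ (Subtype.ext ?_)
      · simp only [h3, θ.symm_apply_apply]
      · simp only [height_push, max_eq_right (h1 _ (one_le_height x)), hinv,
          max_eq_right (one_le_height x)]
        rfl
    rw [h4, θ.apply_symm_apply]
  · rw [push_of_notMem hx, push_of_notMem hx]

lemma push_eq_self_of_notMem_tail (hτ : ∀ t, t ≤ p → τ t = t) {x : M} (hx : x ∉ tail θ p) :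
    push θ τ x = x := by
  by_cases hxL : x ∈ L
  · lift x to L using hxL
    exact push_eq_self x (hτ _ (not_le.1 fun h => hx (coe_mem_tail_iff.2 h)).le)
  · exact push_of_notMem hxL

lemma push_mem_tail (hτ : IsSlide p q τ) {a : ℝ} (ha : τ a = a) {x : M} (hx : x ∈ tail θ a) :
    push θ τ x ∈ tail θ a := by
  have hxL := tail_subset hx
  lift x to L using hxL
  refine (coe_mem_tail_iff (x := ⟨_, push_mem x⟩)).2 ?_
  rw [height_push]
  refine le_max_of_le_right ?_
  rw [← ha]
  exact hτ.monotone (coe_mem_tail_iff.1 hx)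

lemma push_surjective (hp : 1 ≤ p) (hτ : IsSlide p q τ) : Function.Surjective (push θ τ) := by
  intro y
  by_cases hy : y ∈ L
  · lift y to L using hy
    obtain ⟨t, ht⟩ := hτ.surjective (height θ y)
    have ht1 : 1 ≤ t := by
      by_contra hlt
      have h1 : τ t = t := hτ.eq_of_le t ((not_le.1 hlt).le.trans hp)
      have := one_le_height (θ := θ) y
      rw [← ht, h1] at this
      exact hlt this
    refine ⟨θ ((θ.symm y).1, ⟨t, ht1⟩), ?_⟩
    rw [push_coe]
    have : ((θ.symm (θ ((θ.symm y).1, (⟨t, ht1⟩ : Ici (1 : ℝ))))).1,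
        (⟨max 1 (τ (height θ (θ ((θ.symm y).1, ⟨t, ht1⟩)))), mem_Ici.2 (le_max_left _ _)⟩ :
          Ici (1 : ℝ))) = θ.symm y := by
      refine Prod.ext (by simp) (Subtype.ext ?_)
      simp only [height, θ.symm_apply_apply, ht]
      exact max_eq_right (one_le_height y)
    rw [this, θ.apply_symm_apply]
  · exact ⟨y, push_of_notMem hy⟩

/-- A continuous family of self-maps of the half line that are the identity near the frontier of the
end gives rise to a continuous family of self-maps of `M`. -/
lemma continuous_push {W : Type*} [TopologicalSpace W] (hL : IsClosed L)
    (hr : tail θ r ⊆ interior L) (hrp : r < p) {T : W → ℝ → ℝ}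
    (hT : Continuous fun w : W × ℝ => T w.1 w.2) (hTp : ∀ w t, t ≤ p → T w t = t) :
    Continuous fun w : W × M => push θ (T w.1) w.2 := by
  have hin : Continuous fun w : W × L => push θ (T w.1) w.2 := by
    simp_rw [push_coe]
    refine continuous_subtype_val.comp (θ.continuous.comp ?_)
    refine (continuous_fst.comp (θ.symm.continuous.comp continuous_snd)).prodMk
      (Continuous.subtype_mk ?_ _)
    exact continuous_const.max
      (hT.comp (continuous_fst.prodMk (continuous_height.comp continuous_snd)))
  rw [continuous_iff_continuousAt]
  rintro ⟨w, x⟩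
  by_cases hx : x ∈ tail θ p
  · have hxi : x ∈ interior L := hr (tail_anti hrp.le hx)
    have hemb : IsOpenEmbedding (Prod.map id Subtype.val : W × interior L → W × M) :=
      IsOpenEmbedding.id.prodMap isOpen_interior.isOpenEmbedding_subtypeVal
    refine (hemb.continuousAt_iff (x := (w, ⟨x, hxi⟩))).1 ?_
    exact (hin.comp (continuous_id.prodMap (continuous_inclusion interior_subset))).continuousAt
  · have hcl : IsClosed (tail θ p) := by
      have h2 : (Subtype.val '' (Subtype.val ⁻¹' tail θ p : Set L) : Set M) = tail θ p :=
        Subset.antisymm (image_preimage_subset _ _) fun x hx => ⟨⟨x, tail_subset hx⟩, hx, rfl⟩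
      rw [← h2]
      exact hL.isClosedEmbedding_subtypeVal.isClosedMap _ isClosed_preimage_tail
    refine continuous_snd.continuousAt.congr ?_
    filter_upwards [(hcl.isOpen_compl.preimage continuous_snd).mem_nhds
      (show (w, x) ∈ Prod.snd ⁻¹' (tail θ p)ᶜ from hx)] with v hv
    exact (push_eq_self_of_notMem_tail (hTp v.1) hv).symm

lemma push_eq_self_of_notMem_image (hτ : ∀ t, q ≤ t → τ t = t) {x : M}
    (hx : x ∉ (Subtype.val '' {x : L | height θ x ≤ q} : Set M)) : push θ τ x = x := by
  by_cases hxL : x ∈ L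
  · lift x to L using hxL
    exact push_eq_self x (hτ _ (not_le.1 fun h => hx ⟨x, h, rfl⟩).le)
  · exact push_of_notMem hxL

lemma uniformContinuous_push [CompactSpace S] (hL : IsClosed L) (hr : tail θ r ⊆ interior L)
    (hrp : r < p) (hτ : IsSlide p q τ) : UniformContinuous (push θ τ) := by
  have hc : Continuous (push θ τ) :=
    (continuous_push (W := Unit) (T := fun _ => τ) hL hr hrp
      (hτ.continuous.comp continuous_snd) fun _ => hτ.eq_of_le).comp
      (continuous_const.prodMk continuous_id : Continuous fun x : M => (((), x) : Unit × M))
  have hK := (isCompact_height_le θ q).image (continuous_subtype_val (p := fun x => x ∈ L))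
  refine uniformContinuous_of_compact_overlap hc (P := Subtype.val '' {x : L | height θ x ≤ q})
    (hK.uniformContinuousOn_of_continuous hc.continuousOn) ?_ hK one_pos
    fun x hx _ _ _ => Or.inl hx
  exact uniformContinuous_id.uniformContinuousOn.congr fun x hx =>
    (push_eq_self_of_notMem_image hτ.eq_of_ge hx).symm

/-- A strictly monotone slide gives rise to a uniform self-homeomorphism of `M`. -/
lemma exists_uniformEquiv_push [CompactSpace S] (hL : IsClosed L) (hr : tail θ r ⊆ interior L)
    (hrp : r < p) (hp : 1 ≤ p) (hτ : IsSlide p q τ) (hs : StrictMono τ) :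
    ∃ e : M ≃ᵤ M, ∀ x, e x = push θ τ x := by
  obtain ⟨τ', hτ', h1, h2⟩ := hτ.exists_inverse hs
  exact ⟨⟨⟨push θ τ, push θ τ', push_push (fun _ => hτ.le_apply hp) h1,
    push_push (fun _ => hτ'.le_apply hp) h2⟩, uniformContinuous_push hL hr hrp hτ,
    uniformContinuous_push hL hr hrp hτ'⟩, fun x => rfl⟩

lemma eventually_dist_push_lt [CompactSpace S] {W : Type*} [TopologicalSpace W] (hL : IsClosed L)
    (hr : tail θ r ⊆ interior L) (hrp : r < p) {T : W → ℝ → ℝ}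
    (hT : Continuous fun w : W × ℝ => T w.1 w.2) (hTs : ∀ w, IsSlide p q (T w)) (w₀ : W) {η : ℝ}
    (hη : 0 < η) : ∀ᶠ w in 𝓝 w₀, ∀ x, dist (push θ (T w) x) (push θ (T w₀) x) < η := by
  have hc := continuous_push hL hr hrp hT fun w => (hTs w).eq_of_le
  have hK := (isCompact_height_le θ q).image (continuous_subtype_val (p := fun x => x ∈ L))
  have h1 := hK.eventually_forall_of_forall_eventually (x₀ := w₀)
    (P := fun w x => dist (push θ (T w) x) (push θ (T w₀) x) < η) fun x _ => by
      have h2 : Continuous fun z : W × M => dist (push θ (T z.1) z.2) (push θ (T w₀) z.2) :=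
        hc.dist (hc.comp (continuous_const.prodMk continuous_snd))
      refine (h2.tendsto (w₀, x)).eventually (gt_mem_nhds ?_)
      simpa using hη
  filter_upwards [h1] with w hw x
  by_cases hx : x ∈ (Subtype.val '' {x : L | height θ x ≤ q} : Set M)
  · exact hw x hx
  · rw [push_eq_self_of_notMem_image (hTs w).eq_of_ge hx,
      push_eq_self_of_notMem_image (hTs w₀).eq_of_ge hx, dist_self]
    exact hη

lemma exists_dist_push_le [CompactSpace S] (θ : S × Ici (1 : ℝ) ≃ₜ L) (p : ℝ) {q : ℝ} (hq : 1 ≤ q) :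
    ∃ D : ℝ, 0 ≤ D ∧ ∀ τ, IsSlide p q τ → ∀ x, dist (push θ τ x) x ≤ D := by
  have hK := (isCompact_height_le θ q).image (continuous_subtype_val (p := fun x => x ∈ L))
  refine ⟨Metric.diam (Subtype.val '' {x : L | height θ x ≤ q} : Set M), Metric.diam_nonneg,
    fun τ hτ x => ?_⟩
  by_cases hx : x ∈ (Subtype.val '' {x : L | height θ x ≤ q} : Set M)
  · refine Metric.dist_le_diam_of_mem hK.isBounded ?_ hx
    obtain ⟨x, hx, rfl⟩ := hx
    refine ⟨⟨_, push_mem x⟩, ?_, rfl⟩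
    show height θ ⟨push θ τ x, push_mem x⟩ ≤ q
    rw [height_push]
    refine max_le hq ?_
    rw [← hτ.eq_of_ge q le_rfl]
    exact hτ.monotone hx
  · rw [push_eq_self_of_notMem_image hτ.eq_of_ge hx, dist_self]
    exact Metric.diam_nonneg

end Push

/-! ### Conjugation by slides -/

section Conjugation

variable {M S : Type*} [MetricSpace M] [TopologicalSpace S] {n : ℕ} {L F : Set M}
  {θ : S × Ici (1 : ℝ) ≃ₜ L}

/-- The distance of a bounded embedding to the inclusion over the subset `B`. -/
noncomputable def deviationOn (B : Set M) (f : boundedEmb n F ∅) : ℝ :=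
  (edist (UniformFun.ofFun fun x : {x : F // (x : M) ∈ B} => UniformFun.toFun (f : F →ᵤ M) x.1)
    (UniformFun.ofFun fun x : {x : F // (x : M) ∈ B} => (x.1 : M))).toReal

lemma edist_deviationOn_ne_top (B : Set M) (f : boundedEmb n F ∅) :
    edist (UniformFun.ofFun fun x : {x : F // (x : M) ∈ B} => UniformFun.toFun (f : F →ᵤ M) x.1)
      (UniformFun.ofFun fun x : {x : F // (x : M) ∈ B} => (x.1 : M)) ≠ ⊤ := by
  refine (lt_of_le_of_lt (UniformFun.edist_le.2 fun x => ?_) f.2.2).ne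
  exact UniformFun.edist_eval_le (f := (f : F →ᵤ M)) (g := incl F) (x := x.1)

lemma continuous_deviationOn (B : Set M) :
    Continuous (deviationOn B : boundedEmb n F ∅ → ℝ) := by
  have h1 : Continuous fun f : boundedEmb n F ∅ => (UniformFun.ofFun
      fun x : {x : F // (x : M) ∈ B} => UniformFun.toFun (f : F →ᵤ M) x.1) := by
    refine continuous_of_edist_le (g := fun f : boundedEmb n F ∅ => (f : F →ᵤ M))
      continuous_subtype_val fun f g => UniformFun.edist_le.2 fun x => ?_
    exact UniformFun.edist_eval_le (f := (f : F →ᵤ M)) (g := (g : F →ᵤ M)) (x := x.1)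
  rw [continuous_iff_continuousAt]
  intro f
  exact (ENNReal.tendsto_toReal (edist_deviationOn_ne_top B f)).comp
    ((h1.edist continuous_const).tendsto f)

lemma deviationOn_nonneg (B : Set M) (f : boundedEmb n F ∅) : 0 ≤ deviationOn B f :=
  ENNReal.toReal_nonneg

lemma deviationOn_eq_zero_iff {B : Set M} {f : boundedEmb n F ∅} :
    deviationOn B f = 0 ↔ ∀ x : F, (x : M) ∈ B → UniformFun.toFun (f : F →ᵤ M) x = x := by
  rw [deviationOn, ENNReal.toReal_eq_zero_iff, or_iff_left (edist_deviationOn_ne_top B f),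
    ← nonpos_iff_eq_zero, UniformFun.edist_le]
  simp only [nonpos_iff_eq_zero, edist_eq_zero]
  exact ⟨fun h x hx => h ⟨x, hx⟩, fun h x => h x.1 x.2⟩

lemma IsSlide.push_mem_iff {τ : ℝ → ℝ} {p q : ℝ} (hτ : IsSlide p q τ) (hpF : tail θ p ⊆ F) {x : M} :
    push θ τ x ∈ F ↔ x ∈ F := by
  by_cases hx : x ∈ tail θ p
  · exact iff_of_true (hpF (push_mem_tail hτ (hτ.eq_of_le p le_rfl) hx)) (hpF hx)
  · rw [push_eq_self_of_notMem_tail hτ.eq_of_le hx]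

/-- A slide along the end that does not move points of height at most `p > r` modifies embeddings
by conjugation, within `tail θ r`. If it is not invertible, an embedding that commutes with it takes
the place of its conjugate. -/
lemma isModification_of_push_comp {τ : ℝ → ℝ} {p q r : ℝ} (hr : tail θ r ⊆ interior L)
    (hrp : r < p) (hp : 1 ≤ p) (hpF : tail θ p ⊆ F) (hτ : IsSlide p q τ) {f g : F →ᵤ M}
    (hg : ∀ x (hx : push θ τ x ∈ F) (hx' : x ∈ F), UniformFun.toFun g ⟨push θ τ x, hx⟩ =
      push θ τ (UniformFun.toFun f ⟨x, hx'⟩))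
    (hb : (∀ x : F, (x : M) ∈ manifoldBoundary n M → UniformFun.toFun f x = x) →
      ∀ x : F, (x : M) ∈ manifoldBoundary n M → UniformFun.toFun g x = x) :
    IsModification n (tail θ r) f g := by
  have hid : ∀ x, x ∉ interior (tail θ r) → push θ τ x = x := fun x hx =>
    push_eq_self_of_notMem_tail hτ.eq_of_le fun h => hx (tail_subset_interior_tail hr hrp h)
  refine ⟨fun x hfx hx => ?_, fun hA => ?_, hb⟩
  · have h1 : push θ τ x ∈ F := by rw [hid x hx]; exact x.2
    have h2 := hg x h1 x.2
    have h3 : (⟨push θ τ x, h1⟩ : F) = x := Subtype.ext (hid x hx)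
    rwa [hid _ hfx, h3] at h2
  · have hmaps : ∀ y ∈ range (UniformFun.toFun f), push θ τ y ∈ range (UniformFun.toFun f) := by
      intro y hy
      by_cases hyp : y ∈ tail θ p
      · exact hA (tail_anti hrp.le (push_mem_tail hτ (hτ.eq_of_le p le_rfl) hyp))
      · rwa [push_eq_self_of_notMem_tail hτ.eq_of_le hyp]
    refine Subset.antisymm ?_ ?_
    · rintro _ ⟨y, rfl⟩
      obtain ⟨x, hx⟩ := push_surjective (θ := θ) hp hτ (y : M)
      have hpx : push θ τ x ∈ F := by rw [hx]; exact y.2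
      have hxF : x ∈ F := (hτ.push_mem_iff hpF).1 hpx
      have h1 := hg x hpx hxF
      have h2 : (⟨push θ τ x, hpx⟩ : F) = y := Subtype.ext hx
      rw [h2] at h1
      rw [h1]
      exact hmaps _ (mem_range_self _)
    · intro y hy
      obtain ⟨z, hz⟩ := push_surjective (θ := θ) hp hτ y
      have hzr : z ∈ range (UniformFun.toFun f) := by
        by_cases hzp : z ∈ tail θ p
        · exact hA (tail_anti hrp.le hzp)
        · rw [push_eq_self_of_notMem_tail hτ.eq_of_le hzp] at hz
          rwa [hz]
      obtain ⟨x, rfl⟩ := hzr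
      have hpx : push θ τ x ∈ F := (hτ.push_mem_iff hpF).2 x.2
      exact ⟨⟨push θ τ x, hpx⟩, (hg x hpx x.2).trans hz⟩

/-- The conjugate of a bounded embedding by an invertible slide. -/
lemma exists_conjugate [CompactSpace S] {τ : ℝ → ℝ} {p q r : ℝ} (hL : IsClosed L)
    (hr : tail θ r ⊆ interior L) (hrp : r < p) (hp : 1 ≤ p) (hpF : tail θ p ⊆ F)
    (hτ : IsSlide p q τ) (hs : StrictMono τ) (f : boundedEmb n F ∅) {D : ℝ}
    (hD : ∀ x, dist (push θ τ x) x ≤ D) :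
    ∃ g : boundedEmb n F ∅, (∀ x (hx : push θ τ x ∈ F) (hx' : x ∈ F),
        UniformFun.toFun (g : F →ᵤ M) ⟨push θ τ x, hx⟩ =
          push θ τ (UniformFun.toFun (f : F →ᵤ M) ⟨x, hx'⟩)) ∧
      IsModification n (tail θ r) (f : F →ᵤ M) (g : F →ᵤ M) := by
  obtain ⟨e, he⟩ := exists_uniformEquiv_push hL hr hrp hp hτ hs
  have heF : ∀ x, e x ∈ F ↔ x ∈ F := fun x => by rw [he]; exact hτ.push_mem_iff hpF
  have hesF : ∀ x, e.symm x ∈ F ↔ x ∈ F := fun x => by rw [← heF, e.apply_symm_apply]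
  have heb : ∀ x, e x ∈ manifoldBoundary n M ↔ x ∈ manifoldBoundary n M := fun x =>
    mem_manifoldBoundary_iff_of_isOpenEmbedding e.toHomeomorph.isOpenEmbedding x
  have hesb : ∀ x, e.symm x ∈ manifoldBoundary n M ↔ x ∈ manifoldBoundary n M := fun x => by
    rw [← heb, e.apply_symm_apply]
  let eF : F ≃ᵤ F :=
    { toFun := fun x => ⟨e x, (heF x).2 x.2⟩
      invFun := fun x => ⟨e.symm x, (hesF x).2 x.2⟩
      left_inv := fun x => Subtype.ext (e.symm_apply_apply _)
      right_inv := fun x => Subtype.ext (e.apply_symm_apply _)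
      uniformContinuous_toFun :=
        (e.uniformContinuous.comp uniformContinuous_subtype_val).subtype_mk _
      uniformContinuous_invFun :=
        (e.symm.uniformContinuous.comp uniformContinuous_subtype_val).subtype_mk _ }
  let g₀ : F → M := fun x => e (UniformFun.toFun (f : F →ᵤ M) (eF.symm x))
  have hg : ∀ x (hx : push θ τ x ∈ F) (hx' : x ∈ F), g₀ ⟨push θ τ x, hx⟩ =
      push θ τ (UniformFun.toFun (f : F →ᵤ M) ⟨x, hx'⟩) := by
    intro x hx hx'
    have h1 : eF.symm ⟨push θ τ x, hx⟩ = ⟨x, hx'⟩ :=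
      eF.injective ((eF.apply_symm_apply _).trans (Subtype.ext (he x).symm))
    simp only [g₀, h1, he]
  have hprop : UniformFun.ofFun g₀ ∈ properEmb n F ∅ := by
    refine ⟨e.isUniformEmbedding.comp (f.2.1.1.comp eF.symm.isUniformEmbedding), fun x => ?_,
      fun x hx => absurd hx (notMem_empty _)⟩
    exact (heb _).trans ((f.2.1.2.1 _).trans (hesb x))
  refine ⟨⟨UniformFun.ofFun g₀, hprop, ?_⟩, hg,
    isModification_of_push_comp hr hrp hp hpF hτ hg fun hf x hx => ?_⟩
  · refine lt_of_le_of_lt (UniformFun.edist_le.2 fun x => ?_)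
      (ENNReal.ofReal_lt_top (r := D + deviation f + D))
    rw [edist_dist]
    refine ENNReal.ofReal_le_ofReal ?_
    have h1 : dist (g₀ x) (UniformFun.toFun (f : F →ᵤ M) (eF.symm x)) ≤ D := by
      simp only [g₀, he]; exact hD _
    have h2 := dist_le_deviation f (eF.symm x)
    have h3 : dist ((eF.symm x : F) : M) x ≤ D := by
      have h4 := hD (eF.symm x : F)
      rw [← he, dist_comm] at h4
      rwa [show e (eF.symm x : F) = x from e.apply_symm_apply _] at h4
    calc dist (g₀ x) x ≤ dist (g₀ x) (UniformFun.toFun (f : F →ᵤ M) (eF.symm x)) +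
          dist (UniformFun.toFun (f : F →ᵤ M) (eF.symm x)) (eF.symm x : F) +
          dist ((eF.symm x : F) : M) x := dist_triangle4 _ _ _ _
      _ ≤ D + deviation f + D := by gcongr
  · show g₀ x = x
    have h1 := hf (eF.symm x) ((hesb x).2 hx)
    simp only [g₀, h1]
    exact e.apply_symm_apply _

/-- A deformation of the bounded embeddings that fixes those that are the identity on `tail θ s` and
turns those that are the identity on the smaller `tail θ b` into such. The embedding `f` is
conjugated by slides that move `tail θ b` to `tail θ s` and fix the points of height at most
`s - ε`, where `ε` is bounded by the deviation of `f` from the identity over `tail θ s`. As this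
deviation tends to `0`, the slides converge to a map that is not invertible, but commutes with the
embeddings that are the identity on `tail θ s`. -/
theorem exists_conjugation_deformation [CompactSpace S] (hL : IsClosed L) {r s b : ℝ} (hr1 : 1 < r)
    (hrs : r < s) (hsb : s < b) (hrF : tail θ r ⊆ interior (F ∩ L)) :
    ∃ (D : ℝ) (C : boundedEmb n F ∅ × unitInterval → boundedEmb n F ∅),
      Continuous C ∧ (∀ f, C (f, 0) = f) ∧
      (∀ f : boundedEmb n F ∅, (∀ x : F, (x : M) ∈ tail θ b → UniformFun.toFun (f : F →ᵤ M) x = x) →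
        ∀ x : F, (x : M) ∈ tail θ s → UniformFun.toFun (C (f, 1) : F →ᵤ M) x = x) ∧
      (∀ f : boundedEmb n F ∅,
        (∀ x : F, (x : M) ∈ tail θ s → UniformFun.toFun (f : F →ᵤ M) x = x) → ∀ t, C (f, t) = f) ∧
      (∀ (f : boundedEmb n F ∅) t,
        IsModification n (tail θ r) (f : F →ᵤ M) (C (f, t) : F →ᵤ M)) ∧
      ∀ f t, deviation (C (f, t)) ≤ deviation f + D := by
  have hr : tail θ r ⊆ interior L := fun x hx => interior_mono inter_subset_right (hrF hx)
  set p : ℝ := (r + s) / 2 with hp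
  have hrp : r < p := by rw [hp]; linarith
  have hps : p < s := by rw [hp]; linarith
  have hp1 : 1 ≤ p := by linarith
  have hpF : tail θ p ⊆ F := fun x hx => (interior_subset (hrF (tail_anti hrp.le hx))).1
  have hsF : tail θ s ⊆ F := (tail_anti hps.le).trans hpF
  set q : ℝ := b + 1 with hq
  let ε : boundedEmb n F ∅ → ℝ := fun f => min (s - p) (deviationOn (tail θ s) f)
  have hεc : Continuous ε := continuous_const.min (continuous_deviationOn _)
  have hε0 : ∀ f, 0 ≤ ε f := fun f => le_min (by linarith) (deviationOn_nonneg _ _)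
  have hεp : ∀ f, p ≤ s - ε f := fun f => by
    have : ε f ≤ s - p := min_le_left _ _
    linarith
  let T : boundedEmb n F ∅ × unitInterval → ℝ → ℝ := fun w => slide s b (ε w.1) w.2
  have hT : Continuous fun w : (boundedEmb n F ∅ × unitInterval) × ℝ => T w.1 w.2 :=
    continuous_slide hsb (by fun_prop) (fun w => hε0 _) (by fun_prop) continuous_snd
  have hTs : ∀ w, IsSlide p q (T w) := fun w =>
    ⟨hT.comp (continuous_const.prodMk continuous_id),
      monotone_slide hsb (hε0 _) w.2.2.1 w.2.2.2,
      fun t ht => slide_of_le hsb (hε0 _) (ht.trans (hεp _)), fun t ht => slide_of_ge ht⟩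
  obtain ⟨D, hD0, hD⟩ := exists_dist_push_le θ p (q := q) (by linarith)
  have hεpos : ∀ f : boundedEmb n F ∅,
      ¬ (∀ x : F, (x : M) ∈ tail θ s → UniformFun.toFun (f : F →ᵤ M) x = x) → 0 < ε f := by
    intro f hf
    refine lt_min (by linarith) (lt_of_le_of_ne (deviationOn_nonneg _ _) fun h => ?_)
    exact hf (deviationOn_eq_zero_iff.1 h.symm)
  have hexists : ∀ w : boundedEmb n F ∅ × unitInterval, ∃ g : boundedEmb n F ∅,
      (∀ x (hx : push θ (T w) x ∈ F) (hx' : x ∈ F),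
        UniformFun.toFun (g : F →ᵤ M) ⟨push θ (T w) x, hx⟩ =
          push θ (T w) (UniformFun.toFun (w.1 : F →ᵤ M) ⟨x, hx'⟩)) ∧
      IsModification n (tail θ r) (w.1 : F →ᵤ M) (g : F →ᵤ M) ∧
      ((∀ x : F, (x : M) ∈ tail θ s → UniformFun.toFun (w.1 : F →ᵤ M) x = x) → g = w.1) := by
    rintro ⟨f, u⟩
    by_cases hf : ∀ x : F, (x : M) ∈ tail θ s → UniformFun.toFun (f : F →ᵤ M) x = x
    · refine ⟨f, fun x hx hx' => ?_, IsModification.refl _ _, fun _ => rfl⟩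
      have hε : ε f = 0 := by
        have : deviationOn (tail θ s) f = 0 := deviationOn_eq_zero_iff.2 hf
        simp only [ε, this]
        exact min_eq_right (by linarith)
      have hTle : ∀ t, t ≤ s → T (f, u) t = t := fun t ht =>
        slide_of_le hsb (hε0 _) (by rw [hε]; linarith)
      show UniformFun.toFun (f : F →ᵤ M) ⟨push θ (T (f, u)) x, hx⟩ =
        push θ (T (f, u)) (UniformFun.toFun (f : F →ᵤ M) ⟨x, hx'⟩)
      by_cases hxs : x ∈ tail θ s
      · rw [hf ⟨x, hx'⟩ hxs]
        exact hf ⟨_, hx⟩ (push_mem_tail (hTs _) (hTle s le_rfl) hxs)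
      · have h1 : push θ (T (f, u)) x = x := push_eq_self_of_notMem_tail hTle hxs
        have h2 : UniformFun.toFun (f : F →ᵤ M) ⟨x, hx'⟩ ∉ tail θ s := fun h => by
          have h3 := hf ⟨_, hsF h⟩ h
          have h4 := congrArg Subtype.val (f.2.1.1.injective h3)
          simp only at h4
          rw [h4] at h
          exact hxs h
        have h3 : (⟨push θ (T (f, u)) x, hx⟩ : F) = ⟨x, hx'⟩ := Subtype.ext h1
        rw [push_eq_self_of_notMem_tail hTle h2, h3]
    · obtain ⟨g, hg1, hg2⟩ := exists_conjugate hL hr hrp hp1 hpF (hTs (f, u))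
        (strictMono_slide hsb (hεpos f hf) u.2.1 u.2.2) f (hD _ (hTs (f, u)))
      exact ⟨g, hg1, hg2, fun h => absurd h hf⟩
  choose C hC hCmod hCfix using hexists
  have hpre : ∀ w (y : F), ∃ x : F, ∃ hx : push θ (T w) x ∈ F, (⟨push θ (T w) x, hx⟩ : F) = y := by
    intro w y
    obtain ⟨x, hx⟩ := push_surjective (θ := θ) hp1 (hTs w) (y : M)
    have hpx : push θ (T w) x ∈ F := by rw [hx]; exact y.2
    exact ⟨⟨x, ((hTs w).push_mem_iff hpF).1 hpx⟩, hpx, Subtype.ext hx⟩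
  refine ⟨2 * D, C, ?_, fun f => ?_, fun f hf x hx => ?_, fun f hf t => hCfix (f, t) hf,
    fun f t => hCmod (f, t), fun f t => ?_⟩
  · rw [continuous_iff_continuousAt]
    intro w₀
    refine tendsto_subtype_rng.2 (UniformFun.tendsto_iff_tendstoUniformly.2 ?_)
    rw [Metric.tendstoUniformly_iff]
    intro η hη
    have hη3 : 0 < η / 3 := by positivity
    obtain ⟨δ₁, hδ₁, h₁⟩ := Metric.uniformContinuous_iff.1
      (C w₀).2.1.1.uniformContinuous (η / 3) hη3
    obtain ⟨δ₂, hδ₂, h₂⟩ := Metric.uniformContinuous_iff.1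
      (uniformContinuous_push hL hr hrp (hTs w₀)) (η / 3) hη3
    have hf : Filter.Tendsto (fun w : boundedEmb n F ∅ × unitInterval => (w.1 : F →ᵤ M)) (𝓝 w₀)
        (𝓝 (w₀.1 : F →ᵤ M)) := (continuous_subtype_val.comp continuous_fst).tendsto w₀
    have hf' := Metric.tendstoUniformly_iff.1 (UniformFun.tendsto_iff_tendstoUniformly.1 hf) δ₂ hδ₂
    filter_upwards [eventually_dist_push_lt hL hr hrp hT hTs w₀ (lt_min hδ₁ hη3), hf']
      with w hw hwf y
    obtain ⟨x, hx, rfl⟩ := hpre w y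
    have hx₀ : push θ (T w₀) x ∈ F := ((hTs w₀).push_mem_iff hpF).2 x.2
    have e1 := hC w x hx x.2
    have e2 := hC w₀ x hx₀ x.2
    have d1 : dist (UniformFun.toFun (C w₀ : F →ᵤ M) ⟨push θ (T w) x, hx⟩)
        (UniformFun.toFun (C w₀ : F →ᵤ M) ⟨push θ (T w₀) x, hx₀⟩) < η / 3 :=
      h₁ ((hw x).trans_le (min_le_left _ _))
    have d2 : dist (push θ (T w₀) (UniformFun.toFun (w₀.1 : F →ᵤ M) x))
        (push θ (T w₀) (UniformFun.toFun (w.1 : F →ᵤ M) x)) < η / 3 := h₂ (hwf x)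
    have d3 := (hw (UniformFun.toFun (w.1 : F →ᵤ M) x)).trans_le (min_le_right _ _)
    rw [dist_comm] at d3
    rw [e2] at d1
    show dist (UniformFun.toFun (C w₀ : F →ᵤ M) ⟨push θ (T w) x, hx⟩)
      (UniformFun.toFun (C w : F →ᵤ M) ⟨push θ (T w) x, hx⟩) < η
    rw [e1]
    refine (dist_triangle4 _ _ _ _).trans_lt (lt_of_lt_of_eq
      (add_lt_add (add_lt_add d1 d2) d3) (by ring))
  · have hT0 : ∀ t, T (f, 0) t = t := fun t => slide_zero
    have hid : ∀ x, push θ (T (f, 0)) x = x := fun x => by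
      by_cases hx : x ∈ L
      · exact push_eq_self ⟨x, hx⟩ (hT0 _)
      · exact push_of_notMem hx
    refine Subtype.ext (UniformFun.toFun.injective (funext fun y => ?_))
    have h1 : push θ (T (f, 0)) y ∈ F := by rw [hid]; exact y.2
    have h2 := hC (f, 0) y h1 y.2
    have h3 : (⟨push θ (T (f, 0)) y, h1⟩ : F) = y := Subtype.ext (hid y)
    rwa [hid (UniformFun.toFun _ _), h3] at h2
  · by_cases hfs : ∀ x : F, (x : M) ∈ tail θ s → UniformFun.toFun (f : F →ᵤ M) x = x
    · rw [hCfix (f, 1) hfs]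
      exact hfs x hx
    · have hmono : StrictMono (T (f, 1)) := strictMono_slide hsb (hεpos f hfs) zero_le_one le_rfl
      have hTb : T (f, 1) b = s := slide_one_apply hsb (hε0 f)
      obtain ⟨y, hy, rfl⟩ := hpre (f, 1) x
      have hyb : (y : M) ∈ tail θ b := by
        by_cases hyL : (y : M) ∈ L
        · refine (coe_mem_tail_iff (x := (⟨(y : M), hyL⟩ : L))).2 ?_
          have h1 := (coe_mem_tail_iff (x := (⟨_, push_mem ⟨(y : M), hyL⟩⟩ : L))).1 hx
          rw [height_push, ← hTb] at h1
          rcases le_max_iff.1 h1 with h2 | h2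
          · rw [hTb] at h2
            linarith
          · exact hmono.le_iff_le.1 h2
        · have h1 : push θ (T (f, 1)) (y : M) ∈ L := tail_subset hx
          rw [push_of_notMem hyL] at h1
          exact absurd h1 hyL
      rw [hC (f, 1) y hy y.2]
      show push θ (T (f, 1)) (UniformFun.toFun (f : F →ᵤ M) y) = _
      rw [hf y hyb]
  · refine deviation_le (by have := deviation_nonneg f; positivity) fun y => ?_
    obtain ⟨x, hx, rfl⟩ := hpre (f, t) y
    rw [hC (f, t) x hx x.2]
    have h1 := hD _ (hTs (f, t)) (UniformFun.toFun (f : F →ᵤ M) x)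
    have h2 := hD _ (hTs (f, t)) x
    rw [dist_comm] at h2
    have h3 := dist_le_deviation f x
    calc _ ≤ dist (push θ (T (f, t)) (UniformFun.toFun (f : F →ᵤ M) x))
            (UniformFun.toFun (f : F →ᵤ M) x) + dist (UniformFun.toFun (f : F →ᵤ M) x) x +
            dist (x : M) (push θ (T (f, t)) x) := dist_triangle4 _ _ _ _
      _ ≤ deviation f + 2 * D := by linarith

end Conjugation

/-! ### Retraction of the space of bounded embeddings -/

/-- The case of a single end. -/
theorem exists_retraction_of_end {M S : Type*} [MetricSpace M] [TopologicalSpace S] {n : ℕ}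
    {L : Set M} {θ : S × Ici (1 : ℝ) ≃ₜ L} (hL : IsIsolatedProperProductEnd n L θ)
    (hED : HasED n L) {F : Set M} (hF : IsClosed F) {r s : ℝ} (hr1 : 1 < r) (hrs : r < s)
    (hrF : tail θ r ⊆ interior (F ∩ L)) :
    ∃ φ : boundedEmb n F ∅ × unitInterval → boundedEmb n F ∅,
      IsStrongDeformationRetraction {f : boundedEmb n F ∅ |
        ∀ x : F, (x : M) ∈ tail θ s → UniformFun.toFun (f : F →ᵤ M) x = x} φ ∧
      (∀ (f : boundedEmb n F ∅) t,
        IsModification n (tail θ r) (f : F →ᵤ M) (φ (f, t) : F →ᵤ M)) ∧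
      ∀ α, ∃ β, ∀ f t, deviation f < α → deviation (φ (f, t)) < β := by
  have := hL.productEnd.compact
  refine exists_strongDeformationRetraction_of_sublevel _ continuous_deviation deviation_nonneg
    (Rel := fun f g : boundedEmb n F ∅ => IsModification n (tail θ r) (f : F →ᵤ M) (g : F →ᵤ M))
    (fun f => IsModification.refl _ _) (fun f g h => IsModification.trans) fun R hR => ?_
  obtain ⟨b, R', D, hsb, hDc, hD0, hD1, hDfix, hDmod, hDdev⟩ :=
    exists_deformation_of_hasED hL hED hF hrs hrF hR
  obtain ⟨K, C, hCc, hC0, hC1, hCfix, hCmod, hCdev⟩ :=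
    exists_conjugation_deformation (n := n) hL.closed hr1 hrs hsb hrF
  refine ⟨R' + K, fun p => C (D p, p.2), hCc.comp (hDc.prodMk continuous_snd), fun f => ?_,
    fun f => hC1 _ (hD1 f), fun f hf t => ?_, fun f t => (hDmod f t).trans (hCmod _ t),
    fun f t => ?_⟩
  · show C (D (f, 0), 0) = f
    rw [hC0, hD0]
  · show C (D (f, t), t) = f
    rw [hDfix f hf t, hCfix _ hf]
  · exact (hCdev _ t).trans_lt (by linarith [hDdev f t])

/-- The retractions for finitely many disjoint ends can be composed, since the one for an end does
not affect an embedding that is the identity on the tail of another end. -/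
theorem exists_retraction_of_ends {M : Type*} [MetricSpace M] {n : ℕ} {ι : Type*} {L : ι → Set M}
    {S : ι → Type*} [∀ i, TopologicalSpace (S i)] {θ : ∀ i, S i × Ici (1 : ℝ) ≃ₜ L i}
    (hL : ∀ i, IsIsolatedProperProductEnd n (L i) (θ i))
    (hdisj : Pairwise fun i j => Disjoint (L i) (L j)) (hED : ∀ i, HasED n (L i)) {F : Set M}
    (hF : IsClosed F) {r s : ι → ℝ} (hr : ∀ i, 1 < r i) (hrs : ∀ i, r i < s i)
    (hrF : ∀ i, tail (θ i) (r i) ⊆ interior (F ∩ L i)) (J : Finset ι) :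
    ∃ φ : boundedEmb n F ∅ × unitInterval → boundedEmb n F ∅,
      IsStrongDeformationRetraction {f : boundedEmb n F ∅ |
        ∀ i ∈ J, ∀ x : F, (x : M) ∈ tail (θ i) (s i) → UniformFun.toFun (f : F →ᵤ M) x = x} φ ∧
      (∀ (f : boundedEmb n F ∅) t,
        IsModification n (⋃ i ∈ J, tail (θ i) (r i)) (f : F →ᵤ M) (φ (f, t) : F →ᵤ M)) ∧
      ∀ α, ∃ β, ∀ f t, deviation f < α → deviation (φ (f, t)) < β := by
  classical
  induction J using Finset.induction_on with
  | empty =>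
    exact ⟨fun p => p.1, ⟨continuous_fst, fun _ => rfl,
      fun f i hi => absurd hi (Finset.notMem_empty i),
      fun _ _ _ => rfl⟩, fun f _ => IsModification.refl _ _, fun α => ⟨α, fun _ _ h => h⟩⟩
  | insert i J hiJ ih =>
    obtain ⟨φ, hφ, hφmod, hφdev⟩ := ih
    obtain ⟨ψ, hψ, hψmod, hψdev⟩ :=
      exists_retraction_of_end (hL i) (hED i) hF (hr i) (hrs i) (hrF i)
    refine ⟨fun p => ψ (φ p, p.2), ⟨hψ.continuous.comp (hφ.continuous.prodMk continuous_snd),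
      fun f => ?_, fun f j hj x hx => ?_, fun f hf t => ?_⟩, fun f t => ?_, fun α => ?_⟩
    · show ψ (φ (f, 0), 0) = f
      rw [hφ.zero, hψ.zero]
    · rcases Finset.mem_insert.1 hj with rfl | hjJ
      · exact hψ.one (φ (f, 1)) x hx
      · have h1 := hφ.one f j hjJ x hx
        have hxi : (x : M) ∉ interior (tail (θ i) (r i)) := fun h =>
          (hdisj (fun h => hiJ (h ▸ hjJ) : i ≠ j)).notMem_of_mem_left
            (tail_subset (interior_subset h)) (tail_subset hx)
        exact ((hψmod (φ (f, 1)) 1).eq_of_notMem x (h1.symm ▸ hxi) hxi).trans h1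
    · show ψ (φ (f, t), t) = f
      rw [hφ.fixed f (fun j hj => hf j (Finset.mem_insert_of_mem hj)) t]
      exact hψ.fixed f (hf i (Finset.mem_insert_self i J)) t
    · refine IsModification.trans ((hφmod f t).mono ?_) ((hψmod _ t).mono ?_)
      · exact biUnion_subset_biUnion_left fun j hj => Finset.mem_insert_of_mem hj
      · exact subset_biUnion_of_mem (u := fun j => tail (θ j) (r j))
          (show i ∈ (insert i J : Finset ι) from Finset.mem_insert_self i J)
    · obtain ⟨β, hβ⟩ := hφdev α
      obtain ⟨γ, hγ⟩ := hψdev β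
      exact ⟨γ, fun f t hf => hγ _ t (hβ f t hf)⟩

end MetricEnd

theorem mainTheorem2 {M : Type*} [MetricSpace M] (n m : ℕ)
    (hM : MetricEnd.IsManifoldWithBoundary n M)
    (L : Fin m → Set M) (S : Fin m → Type*) [∀ i, TopologicalSpace (S i)]
    (θ : ∀ i, S i × Set.Ici (1 : ℝ) ≃ₜ L i)
    (hL : ∀ i, MetricEnd.IsIsolatedProperProductEnd n (L i) (θ i))
    (hdisj : Pairwise fun i j => Disjoint (L i) (L j))
    (hED : ∀ i, MetricEnd.HasED n (L i))
    (F : Set M) (hF : ∀ i, MetricEnd.IsCofinalIn F (L i))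
    (r s : Fin m → ℝ) (hr : ∀ i, 1 < r i) (hrs : ∀ i, r i < s i)
    (hrF : ∀ i, MetricEnd.tail (θ i) (r i) ⊆ interior (F ∩ L i)) :
    ∃ φ : MetricEnd.boundedEmb n F ∅ × unitInterval → MetricEnd.boundedEmb n F ∅,
      MetricEnd.IsStrongDeformationRetraction
        {f : MetricEnd.boundedEmb n F ∅ |
          (f : F →ᵤ M) ∈ MetricEnd.boundedEmb n F (⋃ i, MetricEnd.tail (θ i) (s i))} φ ∧
      (∀ (f : MetricEnd.boundedEmb n F ∅) (t : unitInterval),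
        (∀ x : F,
          UniformFun.toFun (f : F →ᵤ M) x ∉ interior (⋃ i, MetricEnd.tail (θ i) (r i)) →
          (x : M) ∉ interior (⋃ i, MetricEnd.tail (θ i) (r i)) →
          UniformFun.toFun (φ (f, t) : F →ᵤ M) x = UniformFun.toFun (f : F →ᵤ M) x) ∧
        ((⋃ i, MetricEnd.tail (θ i) (r i)) ⊆ Set.range (UniformFun.toFun (f : F →ᵤ M)) →
          Set.range (UniformFun.toFun (φ (f, t) : F →ᵤ M)) =
            Set.range (UniformFun.toFun (f : F →ᵤ M))) ∧
        ((∀ x : F, (x : M) ∈ MetricEnd.manifoldBoundary n M →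
            UniformFun.toFun (f : F →ᵤ M) x = x) →
          ∀ x : F, (x : M) ∈ MetricEnd.manifoldBoundary n M →
            UniformFun.toFun (φ (f, t) : F →ᵤ M) x = x)) ∧
      (∀ α : ℝ, 0 < α → ∃ β : ℝ, 0 < β ∧
        ∀ (f : MetricEnd.boundedEmb n F ∅) (t : unitInterval),
          (f : F →ᵤ M) ∈ MetricEnd.ballEmb n F ∅ α →
          (φ (f, t) : F →ᵤ M) ∈ MetricEnd.ballEmb n F ∅ β) := by
  have hAr : ⋃ i ∈ (Finset.univ : Finset (Fin m)), MetricEnd.tail (θ i) (r i) =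
      ⋃ i, MetricEnd.tail (θ i) (r i) := by simp
  -- without ends there is no closedness of `F` to appeal to, and nothing to deform
  rcases isEmpty_or_nonempty (Fin m) with hm | ⟨⟨i₀⟩⟩
  · refine ⟨fun p => p.1, ⟨continuous_fst, fun _ => rfl, fun f => ?_, fun _ _ _ => rfl⟩,
      fun f t => ⟨fun _ _ _ => rfl, fun _ => rfl, fun h => h⟩, fun α hα => ⟨α, hα, fun f t h => h⟩⟩
    refine ⟨⟨f.2.1.1, f.2.1.2.1, fun x hx => ?_⟩, f.2.2⟩
    obtain ⟨i, -⟩ := Set.mem_iUnion.1 hx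
    exact hm.elim i
  · obtain ⟨φ, hφ, hφmod, hφdev⟩ := MetricEnd.exists_retraction_of_ends hL hdisj hED (hF i₀).1 hr
      hrs hrF Finset.univ
    have hA : {f : MetricEnd.boundedEmb n F ∅ |
          (f : F →ᵤ M) ∈ MetricEnd.boundedEmb n F (⋃ i, MetricEnd.tail (θ i) (s i))} =
        {f : MetricEnd.boundedEmb n F ∅ | ∀ i ∈ (Finset.univ : Finset (Fin m)), ∀ x : F,
          (x : M) ∈ MetricEnd.tail (θ i) (s i) → UniformFun.toFun (f : F →ᵤ M) x = x} := by
      ext f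
      constructor
      · intro hf i _ x hx
        exact hf.1.2.2 x (Set.mem_iUnion.2 ⟨i, hx⟩)
      · intro hf
        refine ⟨⟨f.2.1.1, f.2.1.2.1, fun x hx => ?_⟩, f.2.2⟩
        obtain ⟨i, hi⟩ := Set.mem_iUnion.1 hx
        exact hf i (Finset.mem_univ i) x hi
    rw [hAr] at hφmod
    refine ⟨φ, hA ▸ hφ, fun f t => ⟨(hφmod f t).eq_of_notMem, (hφmod f t).range_eq,
      (hφmod f t).boundary⟩, fun α _ => ?_⟩
    obtain ⟨β, hβ⟩ := hφdev α
    refine ⟨max β 1, by positivity, fun f t hf => ?_⟩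
    exact MetricEnd.deviation_lt_iff.1
      ((hβ f t (MetricEnd.deviation_lt_iff.2 hf)).trans_le (le_max_left _ _))
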